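/- Let $d\ge 1$, let $\mathcal S_d$ be the Euclidean unit sphere of $\mathbb R^{d+1}$, and let $\mathcal M(\mathcal S_d)$ be the space of complex Borel measures on $\mathcal S_d$, with the total variation norm $\|\mu\|=|\mu|(\mathcal S_d)$. Equip $\mathcal M(\mathcal S_d)$ with the weak-star topology, i.e. the coarsest topology for which $\mu\mapsto\int_{\mathcal S_d} g\,d\mu$ is continuous for every continuous $g:\mathcal S_d\to\mathbb C$, and its closed unit ball $B_{\mathcal M(\mathcal S_d)}=\{\mu:\|\mu\|\le 1\}$ with the induced topology. For $\mu\in\mathcal M(\mathcal S_d)$ and $\|x\|<1$ let $$P[\mu](x)=\int_{\mathcal S_d}\frac{1-\|x\|^2}{\|x-\xi\|^{d+1}}\,d\mu(\xi)$$ be its Poisson integral and, for $\beta\in\mathbb R$, put $$E(\beta,\mu)=\Big\{y\in\mathcal S_d:\ \limsup_{r\to1^-}\frac{\log|P[\mu](ry)|}{-\log(1-r)}=\beta\Big\},$$ with the convention $\log 0=-\infty$. **Theorem.** There is a residual subset $A$ of $B_{\mathcal M(\mathcal S_d)}$ (a set containing a countable intersection of dense open subsets of $B_{\mathcal M(\mathcal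 S_d)}$) such that for every $\mu\in A$ and every $\beta\in[0,d]$, $$\dim_{\mathcal H} E(\beta,\mu)=d-\beta,$$ where $\dim_{\mathcal H}$ is the Hausdorff dimension for the Euclidean distance. -/

import Mathlib

open MeasureTheory Filter Topology

noncomputable section

namespace PoissonSphere

/-- The euclidean unit sphere `S_d` of `ℝ^(d+1)`, with the metric inherited from `ℝ^(d+1)` and
its Borel σ-algebra. -/
abbrev Sphere (d : ℕ) : Type :=
  Metric.sphere (0 : EuclideanSpace ℝ (Fin (d + 1))) 1

/-- The space `M(S_d)` of complex Borel measures on the sphere. -/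
abbrev Measures (d : ℕ) : Type :=
  ComplexMeasure (Sphere d)

/-- The integral `∫ g dμ` of a complex function `g` against a complex measure `μ` on the sphere. -/
def pairing {d : ℕ} (μ : Measures d) (g : Sphere d → ℂ) : ℂ :=
  VectorMeasure.integral μ g (ContinuousLinearMap.mul ℝ ℂ)

/-- The weak-star topology on `M(S_d)`: the coarsest topology for which `μ ↦ ∫ g dμ` is continuous
for every continuous `g : S_d → ℂ`. -/
instance weakStarTopology (d : ℕ) : TopologicalSpace (Measures d) :=
  TopologicalSpace.induced (fun μ (g : C(Sphere d, ℂ)) => pairing μ g) inferInstance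

/-- The closed unit ball of `M(S_d)` for the total variation norm `‖μ‖ = |μ|(S_d)`. -/
def unitBall (d : ℕ) : Set (Measures d) :=
  {μ | μ.variation Set.univ ≤ 1}

/-- The Poisson kernel `P(x, ξ) = (1 - ‖x‖²) / ‖x - ξ‖^(d+1)`. -/
def kernel {d : ℕ} (x : EuclideanSpace ℝ (Fin (d + 1))) (ξ : Sphere d) : ℝ :=
  (1 - ‖x‖ ^ 2) / ‖x - (ξ : EuclideanSpace ℝ (Fin (d + 1)))‖ ^ (d + 1)

/-- The Poisson integral `P[μ](x) = ∫ P(x, ξ) dμ(ξ)`. -/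
def poissonIntegral {d : ℕ} (μ : Measures d) (x : EuclideanSpace ℝ (Fin (d + 1))) : ℂ :=
  pairing μ (fun ξ => (kernel x ξ : ℂ))

/-- The radial growth exponent `limsup_{r → 1⁻} log |P[μ](ry)| / (-log (1 - r))` at `y`, as an
extended real number; the logarithm is the extended one, with `log 0 = -∞`. -/
def growthExponent {d : ℕ} (μ : Measures d) (y : Sphere d) : EReal :=
  limsup (fun r : ℝ =>
    ENNReal.log ‖poissonIntegral μ (r • (y : EuclideanSpace ℝ (Fin (d + 1))))‖ₑ /
      ((-Real.log (1 - r) : ℝ) : EReal)) (𝓝[<] (1 : ℝ))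

/-- The level set `E(β, μ)` of the growth exponent. -/
def levelSet {d : ℕ} (β : ℝ) (μ : Measures d) : Set (Sphere d) :=
  {y | growthExponent μ y = (β : EReal)}

end PoissonSphere

end

namespace PoissonSphere

variable {d : ℕ}

/-! The upper bound holds for every `μ` in the ball. If `|μ|(B(y, ρ)) ≤ C ρ^t` for all `ρ`, summing
the Poisson kernel over dyadic shells gives `|P[μ](ry)| ≤ C' (1 - r)^(t - d)`, so the exponent at
`y` is at most `d - t`. Where it exceeds `d - t`, the upper `t`-density of `|μ|` is therefore
infinite, and Vitali's covering lemma makes such points an `H^t`-null set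
(`hausdorffMeasure_growthExponent_gt`).

The lower bound is generic. Measures `(1 - 1/n) ∑ c_i δ_{x_i} + (1/n) · (uniform mass on a grid of
step 2^(-n))` are weak-star dense, with `n` as large as desired compared with the number of atoms.
Poisson integrals depend continuously on `μ`, uniformly on smaller balls, so a generic `μ` imitates
such measures up to radius `1 - 2^(-n^2)` for infinitely many `n`
(`residual_frequently_hasLargeValues`). Hence, off a few small balls, a point within about `2^(-t)`
of the grid has `|P[μ]|` of order at least `2^(d(t-n)) / n` at distance `2^(-t)` from the sphere.
This property does not involve `β`, so one residual set serves all `β`.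

For `β < d` put `α = d / (d - β)`. Points within about `2^(-αn)` of the grid for infinitely many of
these `n` have exponent at least `d (1 - 1/α) = β`. Many such points arise by inserting long blocks
of zeros into binary expansions: the inverse of this map is `1/α`-Hölder, so the image of a set of
positive volume has positive `H^(d/α)`-measure, and `d/α = d - β`
(`hausdorffMeasure_le_growthExponent_ne_zero`). Removing the `H^(d-β)`-null set where the exponent
exceeds `β` leaves the level set. -/

/-! ### Pairings and finite sums of Dirac masses -/

lemma isFiniteMeasure_variation {μ : Measures d} (hμ : μ ∈ unitBall d) :
    IsFiniteMeasure μ.variation :=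
  ⟨lt_of_le_of_lt hμ ENNReal.one_lt_top⟩

lemma integrable_of_continuous {μ : Measures d} [IsFiniteMeasure μ.variation]
    {g : Sphere d → ℂ} (hg : Continuous g) : VectorMeasure.Integrable μ g :=
  hg.integrable_of_hasCompactSupport (HasCompactSupport.of_compactSpace g)

lemma norm_pairing_le {μ : Measures d} (hμ : μ ∈ unitBall d) {g : Sphere d → ℂ} {C : ℝ}
    (hC : 0 ≤ C) (hg : ∀ ξ, ‖g ξ‖ ≤ C) : ‖pairing μ g‖ ≤ C := by
  have := isFiniteMeasure_variation hμ
  refine (VectorMeasure.norm_integral_le_of_norm_le_const (Eventually.of_forall hg)).trans ?_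
  have h1 : μ.variation.real Set.univ ≤ 1 := 
    ENNReal.toReal_le_of_le_ofReal zero_le_one (by rw [ENNReal.ofReal_one]; exact hμ)
  have h2 : ‖ContinuousLinearMap.mul ℝ ℂ‖ ≤ 1 := ContinuousLinearMap.opNorm_mul_le ℝ ℂ
  calc _ ≤ C * 1 * 1 := by gcongr
    _ = C := by ring

lemma enorm_pairing_le (μ : Measures d) (g : Sphere d → ℂ) :
    ‖pairing μ g‖ₑ ≤ ∫⁻ ξ, ‖g ξ‖ₑ ∂μ.variation := by
  refine (VectorMeasure.enorm_integral_le_lintegral_enorm).trans ?_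
  have h2 : ‖ContinuousLinearMap.mul ℝ ℂ‖ₑ ≤ 1 := by
    rw [← ofReal_norm]
    simp
  calc _ ≤ 1 * ∫⁻ ξ, ‖g ξ‖ₑ ∂μ.variation := by gcongr
    _ = _ := one_mul _

lemma pairing_sub {μ : Measures d} (hμ : μ ∈ unitBall d) {g h : Sphere d → ℂ}
    (hg : Continuous g) (hh : Continuous h) :
    pairing μ (fun ξ => g ξ - h ξ) = pairing μ g - pairing μ h := by
  have := isFiniteMeasure_variation hμ
  exact VectorMeasure.integral_fun_sub (integrable_of_continuous hg) (integrable_of_continuous hh)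

/-- The finite combination `∑ i ∈ s, c i • δ_{x i}` of Dirac masses. -/
noncomputable def diracSum {ι : Type*} (s : Finset ι) (x : ι → Sphere d) (c : ι → ℂ) : Measures d :=
  ∑ i ∈ s, VectorMeasure.dirac (x i) (c i)

lemma pairing_diracSum {ι : Type*} (s : Finset ι) (x : ι → Sphere d) (c : ι → ℂ)
    {g : Sphere d → ℂ} (hg : Continuous g) :
    pairing (diracSum s x c) g = ∑ i ∈ s, g (x i) * c i := by
  unfold pairing diracSum
  rw [VectorMeasure.integral_finsetSum_vectorMeasure]
  · refine Finset.sum_congr rfl fun i _ => ?_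
    rw [VectorMeasure.integral_dirac]
    simp
  · intro i _
    exact integrable_of_continuous hg

lemma diracSum_variation_le {ι : Type*} (s : Finset ι) (x : ι → Sphere d) (c : ι → ℂ) :
    (diracSum s x c).variation Set.univ ≤ ∑ i ∈ s, ‖c i‖ₑ := by
  have h : (diracSum s x c).variation ≤ _ :=
    VectorMeasure.variation_finsetSum_le s (fun i => VectorMeasure.dirac (x i) (c i))
  refine (h Set.univ).trans ?_
  simp

/-! ### Radial estimates of the Poisson kernel -/

lemma norm_smul_sphere (y : Sphere d) {r : ℝ} (hr : 0 ≤ r) :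
    ‖r • (y : EuclideanSpace ℝ (Fin (d + 1)))‖ = r := by
  rw [norm_smul, norm_eq_of_mem_sphere y, mul_one, Real.norm_of_nonneg hr]

lemma norm_sub_sphere_pos {x : EuclideanSpace ℝ (Fin (d + 1))} (hx : ‖x‖ < 1) (ξ : Sphere d) :
    0 < ‖x - (ξ : EuclideanSpace ℝ (Fin (d + 1)))‖ := by
  rw [norm_pos_iff, sub_ne_zero]
  rintro rfl
  simp at hx

lemma kernel_pos {x : EuclideanSpace ℝ (Fin (d + 1))} (hx : ‖x‖ < 1) (ξ : Sphere d) :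
    0 < kernel x ξ := by
  have := norm_sub_sphere_pos hx ξ
  unfold kernel
  have h : 0 < 1 - ‖x‖ ^ 2 := by nlinarith [norm_nonneg x]
  positivity

lemma continuous_kernel_uncurried :
    Continuous fun p : Metric.ball (0 : EuclideanSpace ℝ (Fin (d + 1))) 1 × Sphere d =>
      (kernel (p.1 : EuclideanSpace ℝ (Fin (d + 1))) p.2 : ℂ) := by
  refine Complex.continuous_ofReal.comp ?_
  unfold kernel
  refine Continuous.div (by fun_prop) (by fun_prop) ?_
  rintro ⟨⟨x, hx⟩, ξ⟩
  exact pow_ne_zero _ (norm_sub_sphere_pos (by simpa using hx) ξ).ne'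

lemma continuous_kernel {x : EuclideanSpace ℝ (Fin (d + 1))} (hx : ‖x‖ < 1) :
    Continuous fun ξ : Sphere d => (kernel x ξ : ℂ) := by
  refine Complex.continuous_ofReal.comp ?_
  unfold kernel
  exact Continuous.div (by fun_prop) (by fun_prop)
    fun ξ => pow_ne_zero _ (norm_sub_sphere_pos hx ξ).ne'

lemma norm_radial_sub_le {s : ℝ} (hs : 0 ≤ s) (y ξ : Sphere d) :
    ‖(1 - s) • (y : EuclideanSpace ℝ (Fin (d + 1))) - ξ‖ ≤ dist y ξ + s := by
  have h : (1 - s) • (y : EuclideanSpace ℝ (Fin (d + 1))) - ξ = (y - ξ : EuclideanSpace ℝ (Fin (d + 1))) - s • y := by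
    rw [sub_smul, one_smul]; abel
  rw [h]
  refine (norm_sub_le _ _).trans ?_
  rw [norm_smul_sphere y hs, Subtype.dist_eq, dist_eq_norm]

lemma le_norm_radial_sub {s : ℝ} (hs : 0 ≤ s) (hs1 : s ≤ 1) (y ξ : Sphere d) :
    s ≤ ‖(1 - s) • (y : EuclideanSpace ℝ (Fin (d + 1))) - ξ‖ ∧
      dist y ξ / 2 ≤ ‖(1 - s) • (y : EuclideanSpace ℝ (Fin (d + 1))) - ξ‖ := by
  have h1 : s ≤ ‖(1 - s) • (y : EuclideanSpace ℝ (Fin (d + 1))) - ξ‖ := by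
    have := norm_sub_norm_le (ξ : EuclideanSpace ℝ (Fin (d + 1))) ((1 - s) • (y : EuclideanSpace ℝ (Fin (d + 1))))
    rw [norm_smul_sphere y (by linarith), norm_eq_of_mem_sphere ξ, norm_sub_rev] at this
    linarith
  refine ⟨h1, ?_⟩
  have h : (y - ξ : EuclideanSpace ℝ (Fin (d + 1))) =
      ((1 - s) • (y : EuclideanSpace ℝ (Fin (d + 1))) - ξ) + s • y := by
    rw [sub_smul, one_smul]; abel
  have h2 : dist y ξ ≤ ‖(1 - s) • (y : EuclideanSpace ℝ (Fin (d + 1))) - ξ‖ + s := by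
    rw [Subtype.dist_eq, dist_eq_norm, h]
    refine (norm_add_le _ _).trans ?_
    rw [norm_smul_sphere y hs]
  linarith

/-- The numerator is `1 - (1 - s)^2 ≤ 2 s`, and both `s` and `dist y ξ / 2` bound the distance in
the denominator from below. -/
lemma kernel_radial_le {s a : ℝ} (hs : 0 < s) (hs1 : s ≤ 1) (ha : 0 < a) (y ξ : Sphere d)
    (h : a ≤ s ∨ a ≤ dist y ξ / 2) :
    kernel ((1 - s) • (y : EuclideanSpace ℝ (Fin (d + 1)))) ξ ≤ 2 * s / a ^ (d + 1) := by
  obtain ⟨h1, h2⟩ := le_norm_radial_sub hs.le hs1 y ξ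
  have h3 : a ≤ ‖(1 - s) • (y : EuclideanSpace ℝ (Fin (d + 1))) - ξ‖ := by
    rcases h with h | h <;> linarith
  unfold kernel
  rw [norm_smul_sphere y (by linarith)]
  gcongr
  nlinarith

lemma le_kernel_radial {s a : ℝ} (hs : 0 < s) (hs1 : s < 1) (y ξ : Sphere d)
    (h : dist y ξ ≤ a * s) :
    s / ((a + 1) * s) ^ (d + 1) ≤ kernel ((1 - s) • (y : EuclideanSpace ℝ (Fin (d + 1)))) ξ := by
  have h1 := norm_radial_sub_le hs.le y ξ
  have h0 : 0 < ‖(1 - s) • (y : EuclideanSpace ℝ (Fin (d + 1))) - ξ‖ :=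
    norm_sub_sphere_pos (by rw [norm_smul_sphere y (by linarith)]; linarith) ξ
  unfold kernel
  rw [norm_smul_sphere y (by linarith)]
  gcongr
  · nlinarith
  · nlinarith
  · nlinarith

lemma poissonIntegral_diracSum {ι : Type*} (s : Finset ι) (x : ι → Sphere d) (c : ι → ℂ)
    {z : EuclideanSpace ℝ (Fin (d + 1))} (hz : ‖z‖ < 1) :
    poissonIntegral (diracSum s x c) z = ∑ i ∈ s, (kernel z (x i) : ℂ) * c i :=
  pairing_diracSum s x c (continuous_kernel hz)

/-! ### Upper bound: densities and radial growth -/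

/-- A set all of whose points have infinite upper `t`-density for a finite measure is null for the
`t`-dimensional Hausdorff measure. -/
lemma hausdorffMeasure_eq_zero_of_density {X : Type*} [MetricSpace X]
    [SecondCountableTopology X] [MeasurableSpace X] [BorelSpace X] (m : Measure X)
    [IsFiniteMeasure m] {t : ℝ} (ht : 0 < t) (A : Set X)
    (h : ∀ y ∈ A, ∀ C : ℝ, 0 < C → ∃ ρ : ℝ, 0 < ρ ∧
      ENNReal.ofReal (C * ρ ^ t) < m (Metric.closedBall y ρ)) :
    μH[t] A = 0 := by
  have key : ∀ n : ℕ, ∃ u : Set A, ∃ r : A → ℝ, (∀ y ∈ u, 0 < r y) ∧ u.Countable ∧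
      (∀ y ∈ u, r y ≤ (m.real Set.univ / (n + 1)) ^ t⁻¹) ∧
      A ⊆ ⋃ y ∈ u, Metric.closedBall (y : X) (4 * r y) ∧
      ∑' y : u, ENNReal.ofReal ((r y) ^ t) ≤ ENNReal.ofReal (m.real Set.univ / (n + 1)) := by
    intro n
    have hn : (0 : ℝ) < n + 1 := by positivity
    choose r hr0 hr using fun y : A => h y y.2 (n + 1) hn
    -- Finiteness of `m` forces the radii to be small: the large density constant `n + 1` gives a
    -- covering whose mesh tends to `0`.
    have hr1 : ∀ y : A, (n + 1) * (r y) ^ t ≤ m.real Set.univ := by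
      intro y
      have := ((hr y).le.trans (measure_mono (Set.subset_univ _)))
      rwa [ENNReal.ofReal_le_iff_le_toReal (measure_ne_top _ _)] at this
    have hr2 : ∀ y : A, r y ≤ (m.real Set.univ / (n + 1)) ^ t⁻¹ := by
      intro y
      rw [Real.le_rpow_inv_iff_of_pos (hr0 y).le (by positivity) ht, le_div_iff₀ hn]
      linarith [hr1 y]
    obtain ⟨u, -, hdisj, hcov⟩ := Vitali.exists_disjoint_subfamily_covering_enlargement_closedBall
      (Set.univ : Set A) (fun y => (y : X)) r _ (fun y _ => hr2 y) 4 (by norm_num)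
    have hcount : u.Countable := by
      refine hdisj.countable_of_nonempty_interior fun y _ => ?_
      exact ⟨y, Metric.ball_subset_interior_closedBall (Metric.mem_ball_self (hr0 y))⟩
    refine ⟨u, r, fun y _ => hr0 y, hcount, fun y _ => hr2 y, ?_, ?_⟩
    · intro y hy
      obtain ⟨b, hb, hsub⟩ := hcov ⟨y, hy⟩ (Set.mem_univ _)
      exact Set.mem_biUnion hb (hsub (Metric.mem_closedBall_self (hr0 _).le))
    · have : Countable u := hcount.to_subtype
      have h1 : ∑' y : u, m (Metric.closedBall ((y : A) : X) (r y)) ≤ m Set.univ := by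
        refine tsum_measure_le_measure_univ
          (fun y => Metric.isClosed_closedBall.measurableSet.nullMeasurableSet) ?_
        intro y z hyz
        exact (hdisj y.2 z.2 (fun h => hyz (Subtype.ext h))).aedisjoint
      have h2 : ∀ y : A, ENNReal.ofReal ((r y) ^ t) ≤
          ENNReal.ofReal (n + 1)⁻¹ * m (Metric.closedBall (y : X) (r y)) := by
        intro y
        refine le_trans (le_of_eq ?_) (mul_le_mul_right (hr y).le _)
        rw [← ENNReal.ofReal_mul (by positivity), inv_mul_cancel_left₀ hn.ne']
      calc ∑' y : u, ENNReal.ofReal ((r y) ^ t)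
          ≤ ∑' y : u, ENNReal.ofReal (n + 1)⁻¹ * m (Metric.closedBall ((y : A) : X) (r y)) :=
            ENNReal.tsum_le_tsum fun y => h2 y
        _ = ENNReal.ofReal (n + 1)⁻¹ * ∑' y : u, m (Metric.closedBall ((y : A) : X) (r y)) :=
            ENNReal.tsum_mul_left
        _ ≤ ENNReal.ofReal (n + 1)⁻¹ * m Set.univ := by gcongr
        _ = ENNReal.ofReal (m.real Set.univ / (n + 1)) := by
            rw [div_eq_inv_mul, ENNReal.ofReal_mul (by positivity), measureReal_def,
              ENNReal.ofReal_toReal (measure_ne_top _ _)]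
  choose u r hr0 hcount hr hcov hsum using key
  have : ∀ n, Countable (u n) := fun n => (hcount n).to_subtype
  have hlim : Tendsto (fun n : ℕ => m.real Set.univ / ((n : ℝ) + 1)) atTop (𝓝 0) :=
    tendsto_const_div_atTop_nhds_zero_nat (m.real Set.univ) |>.comp (tendsto_add_atTop_nat 1) |>.congr
      (fun n => by simp)
  have hlim2 : Tendsto (fun n : ℕ => 8 * (m.real Set.univ / ((n : ℝ) + 1)) ^ t⁻¹) atTop (𝓝 0) := by
    have := (hlim.rpow_const (p := t⁻¹) (Or.inr (by positivity))).const_mul 8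
    rwa [Real.zero_rpow (by positivity), mul_zero] at this
  have hlim3 : Tendsto (fun n : ℕ => ENNReal.ofReal (8 ^ t * (m.real Set.univ / ((n : ℝ) + 1))))
      atTop (𝓝 0) := by
    have := ENNReal.tendsto_ofReal (hlim.const_mul (8 ^ t))
    rwa [mul_zero, ENNReal.ofReal_zero] at this
  have hdiam : ∀ (n : ℕ) (y : A), Metric.ediam (Metric.closedBall (y : X) (4 * r n y)) ≤
      ENNReal.ofReal (8 * r n y) := by
    intro n y
    refine Metric.ediam_le_of_forall_dist_le fun a ha b hb => ?_
    have := dist_triangle_right a b (y : X)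
    rw [Metric.mem_closedBall] at ha hb
    linarith
  have hmain := Measure.hausdorffMeasure_le_liminf_tsum t A (l := atTop)
    (fun n : ℕ => ENNReal.ofReal (8 * (m.real Set.univ / ((n : ℝ) + 1)) ^ t⁻¹))
    (by simpa using ENNReal.tendsto_ofReal hlim2)
    (fun n (y : u n) => Metric.closedBall ((y : A) : X) (4 * r n y))
    (Eventually.of_forall fun n y => (hdiam n y).trans
      (ENNReal.ofReal_le_ofReal (by have := hr n y y.2; linarith)))
    (Eventually.of_forall fun n => by
      have := hcov n
      rwa [Set.biUnion_eq_iUnion] at this)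
  refine le_antisymm (hmain.trans ?_) zero_le
  rw [← hlim3.liminf_eq]
  refine liminf_le_liminf (Eventually.of_forall fun n => ?_)
  calc ∑' y : u n, Metric.ediam (Metric.closedBall ((y : A) : X) (4 * r n y)) ^ t
      ≤ ∑' y : u n, ENNReal.ofReal (8 ^ t) * ENNReal.ofReal ((r n y) ^ t) := by
        refine ENNReal.tsum_le_tsum fun y => ?_
        have h0 := (hr0 n y y.2).le
        refine (ENNReal.rpow_le_rpow (hdiam n y) ht.le).trans (le_of_eq ?_)
        rw [ENNReal.ofReal_rpow_of_nonneg (by positivity) ht.le,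
          Real.mul_rpow (by norm_num) h0, ENNReal.ofReal_mul (by positivity)]
    _ = ENNReal.ofReal (8 ^ t) * ∑' y : u n, ENNReal.ofReal ((r n y) ^ t) := ENNReal.tsum_mul_left
    _ ≤ ENNReal.ofReal (8 ^ t) * ENNReal.ofReal (m.real Set.univ / ((n : ℝ) + 1)) := by
        gcongr
        exact hsum n
    _ = _ := by rw [← ENNReal.ofReal_mul (by positivity)]

/-- A single term suffices: take the first ball `B(y, 2^i s)` containing `ξ`. Either `i = 0`, where
the bound by `s` applies, or `ξ` lies outside the preceding ball, so `dist y ξ > 2^i s / 2`. -/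
lemma ofReal_kernel_radial_le_tsum {s : ℝ} (hs : 0 < s) (hs1 : s ≤ 1) (y ξ : Sphere d) :
    ENNReal.ofReal (kernel ((1 - s) • (y : EuclideanSpace ℝ (Fin (d + 1)))) ξ) ≤
      ∑' i : ℕ, ENNReal.ofReal (2 * s / (2 ^ i * s / 4) ^ (d + 1)) *
        (Metric.closedBall y (2 ^ i * s)).indicator 1 ξ := by
  obtain ⟨i, hi, hi'⟩ : ∃ i : ℕ, dist y ξ ≤ 2 ^ i * s ∧
      (2 ^ i * s / 4 ≤ s ∨ 2 ^ i * s / 4 ≤ dist y ξ / 2) := by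
    have hex : ∃ i : ℕ, dist y ξ ≤ 2 ^ i * s := by
      obtain ⟨i, hi⟩ := pow_unbounded_of_one_lt (dist y ξ / s) (one_lt_two)
      exact ⟨i, by rw [div_lt_iff₀ hs] at hi; exact hi.le⟩
    classical
    refine ⟨Nat.find hex, Nat.find_spec hex, ?_⟩
    rcases hn : Nat.find hex with _ | j
    · left; simp; linarith
    · right
      have := Nat.find_min hex (m := j) (by omega)
      rw [not_le] at this
      rw [pow_succ]
      linarith
  refine le_trans ?_ (ENNReal.le_tsum i)
  have hmem : ξ ∈ Metric.closedBall y (2 ^ i * s) := by rwa [Metric.mem_closedBall, dist_comm]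
  rw [Set.indicator_of_mem hmem, Pi.one_apply, mul_one]
  exact ENNReal.ofReal_le_ofReal (kernel_radial_le hs hs1 (by positivity) y ξ hi')

/-- A ball growth condition of order `t` for `|μ|` at `y` bounds the radial growth of the Poisson
integral at `y`. -/
lemma norm_poissonIntegral_radial_le {μ : Measures d} {y : Sphere d}
    {t C : ℝ} (htd : t < d + 1) (hC : 0 ≤ C)
    (h : ∀ ρ : ℝ, 0 < ρ → μ.variation (Metric.closedBall y ρ) ≤ ENNReal.ofReal (C * ρ ^ t)) :
    ∃ C' : ℝ, ∀ s : ℝ, 0 < s → s < 1 →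
      ‖poissonIntegral μ ((1 - s) • (y : EuclideanSpace ℝ (Fin (d + 1))))‖ ≤ C' * s ^ (t - d) := by
  -- Ratio of the geometric series over dyadic balls; it is below `1` because `t < d + 1`.
  set q : ℝ := 2 ^ (t - (d + 1)) with hq
  have hq0 : 0 < q := by positivity
  have hq1 : q < 1 := Real.rpow_lt_one_of_one_lt_of_neg one_lt_two (by linarith)
  refine ⟨2 * 4 ^ (d + 1) * C * (1 - q)⁻¹, fun s hs hs1 => ?_⟩
  have hterm : ∀ i : ℕ, 2 * s / (2 ^ i * s / 4) ^ (d + 1) * (C * (2 ^ i * s) ^ t) =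
      2 * 4 ^ (d + 1) * C * s ^ (t - d) * q ^ i := by
    intro i
    have e1 : s ^ (t - d) = s * s ^ t / s ^ (d + 1) := by
      rw [Real.rpow_sub hs, Real.rpow_natCast, pow_succ]
      field_simp
    have e2 : q ^ i = ((2 : ℝ) ^ i) ^ t / (2 ^ i) ^ (d + 1) := by
      rw [hq, ← Real.rpow_natCast, ← Real.rpow_mul (by norm_num), mul_comm,
        Real.rpow_mul (by norm_num), Real.rpow_natCast, Real.rpow_sub (by positivity)]
      congr 1
      rw [← Nat.cast_succ, Real.rpow_natCast]
    rw [e1, e2, Real.mul_rpow (by positivity) hs.le, div_pow, mul_pow]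
    field_simp
  have hnn : ∀ i : ℕ, 0 ≤ 2 * s / (2 ^ i * s / 4) ^ (d + 1) := fun i => by positivity
  have hbound : ‖poissonIntegral μ ((1 - s) • (y : EuclideanSpace ℝ (Fin (d + 1))))‖ₑ ≤
      ENNReal.ofReal (2 * 4 ^ (d + 1) * C * (1 - q)⁻¹ * s ^ (t - d)) := by
    calc _ ≤ ∫⁻ ξ, ‖((kernel ((1 - s) • (y : EuclideanSpace ℝ (Fin (d + 1)))) ξ : ℝ) : ℂ)‖ₑ
            ∂μ.variation := enorm_pairing_le _ _
      _ ≤ ∫⁻ ξ, ∑' i : ℕ, ENNReal.ofReal (2 * s / (2 ^ i * s / 4) ^ (d + 1)) *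
        (Metric.closedBall y (2 ^ i * s)).indicator 1 ξ ∂μ.variation := by
          refine lintegral_mono fun ξ => ?_
          have hk := kernel_pos (x := (1 - s) • (y : EuclideanSpace ℝ (Fin (d + 1))))
            (by rw [norm_smul_sphere y (by linarith)]; linarith) ξ
          rw [← ofReal_norm, Complex.norm_real, Real.norm_of_nonneg hk.le]
          exact ofReal_kernel_radial_le_tsum hs hs1.le y ξ
      _ = ∑' i : ℕ, ENNReal.ofReal (2 * s / (2 ^ i * s / 4) ^ (d + 1)) *
          μ.variation (Metric.closedBall y (2 ^ i * s)) := by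
          have hm : ∀ i : ℕ, Measurable
              ((Metric.closedBall y (2 ^ i * s)).indicator (1 : Sphere d → ENNReal)) := fun i =>
            measurable_one.indicator Metric.isClosed_closedBall.measurableSet
          rw [lintegral_tsum fun i => ((hm i).const_mul _).aemeasurable]
          congr 1; ext i
          rw [lintegral_const_mul _ (hm i),
            lintegral_indicator_one Metric.isClosed_closedBall.measurableSet]
      _ ≤ ∑' i : ℕ, ENNReal.ofReal (2 * 4 ^ (d + 1) * C * s ^ (t - d) * q ^ i) := by
          refine ENNReal.tsum_le_tsum fun i => ?_
          rw [← hterm, ENNReal.ofReal_mul (hnn i)]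
          gcongr
          exact h _ (by positivity)
      _ = _ := by
          rw [← ENNReal.ofReal_tsum_of_nonneg (fun i => by positivity)
            ((summable_geometric_of_lt_one hq0.le hq1).mul_left _), tsum_mul_left,
            tsum_geometric_of_lt_one hq0.le hq1]
          congr 1; ring
  rw [← ofReal_norm] at hbound
  refine (ENNReal.ofReal_le_ofReal_iff ?_).1 hbound
  have : 0 < 1 - q := by linarith
  positivity

lemma growthExponent_le {μ : Measures d} {y : Sphere d} {C γ : ℝ}
    (h : ∀ s : ℝ, 0 < s → s < 1 →
      ‖poissonIntegral μ ((1 - s) • (y : EuclideanSpace ℝ (Fin (d + 1))))‖ ≤ C * s ^ (-γ)) :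
    growthExponent μ y ≤ (γ : EReal) := by
  -- `C` may be nonpositive; a positive constant is needed to take logarithms.
  set C₁ := max C 1
  have hC1 : 0 < C₁ := lt_max_of_lt_right one_pos
  have hlog : Tendsto (fun r : ℝ => -Real.log (1 - r)) (𝓝[<] 1) atTop := by
    have h1 : Tendsto (fun r : ℝ => 1 - r) (𝓝[<] 1) (𝓝[>] 0) := by
      refine tendsto_nhdsWithin_iff.2 ⟨?_, ?_⟩
      · have : Tendsto (fun r : ℝ => 1 - r) (𝓝 1) (𝓝 (1 - 1)) :=
          tendsto_const_nhds.sub tendsto_id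
        rw [sub_self] at this
        exact this.mono_left nhdsWithin_le_nhds
      · filter_upwards [self_mem_nhdsWithin] with r hr
        simpa using hr
    exact tendsto_neg_atBot_atTop.comp (Real.tendsto_log_nhdsGT_zero.comp h1)
  have hreal : Tendsto (fun r : ℝ => (Real.log C₁ + γ * (-Real.log (1 - r))) / (-Real.log (1 - r)))
      (𝓝[<] 1) (𝓝 γ) := by
    have h1 : Tendsto (fun r : ℝ => Real.log C₁ / (-Real.log (1 - r)) + γ) (𝓝[<] 1) (𝓝 (0 + γ)) :=
      (hlog.const_div_atTop _).add_const _
    rw [zero_add] at h1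
    refine h1.congr' ?_
    filter_upwards [hlog.eventually_gt_atTop 0] with r hr
    rw [add_div, mul_div_cancel_right₀ _ hr.ne']
  have hE := (continuous_coe_real_ereal.tendsto γ).comp hreal
  unfold growthExponent
  rw [← hE.limsup_eq]
  refine limsup_le_limsup ?_
  filter_upwards [hlog.eventually_gt_atTop 0, Ioo_mem_nhdsLT (zero_lt_one' ℝ)] with r hr hr01
  have hs : 0 < 1 - r := by linarith [hr01.2]
  rw [Function.comp_apply, EReal.coe_div]
  refine EReal.div_le_div_right_of_nonneg (by exact_mod_cast hr.le) ?_
  have hb := h (1 - r) hs (by linarith [hr01.1])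
  rw [sub_sub_cancel] at hb
  have hpos : 0 < C₁ * (1 - r) ^ (-γ) := by positivity
  have hb' : ‖poissonIntegral μ (r • (y : EuclideanSpace ℝ (Fin (d + 1))))‖ₑ ≤
      ENNReal.ofReal (C₁ * (1 - r) ^ (-γ)) := by
    rw [← ofReal_norm]
    refine ENNReal.ofReal_le_ofReal (hb.trans ?_)
    gcongr
    exact le_max_left _ _
  refine (ENNReal.log_le_log hb').trans (le_of_eq ?_)
  rw [ENNReal.log_ofReal_of_pos hpos, Real.log_mul hC1.ne' (by positivity), Real.log_rpow hs]
  congr 1; ring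

/-- The points where the growth exponent exceeds `d - t` form an `H^t`-null set. -/
lemma hausdorffMeasure_growthExponent_gt {μ : Measures d} (hμ : μ ∈ unitBall d) {t : ℝ}
    (ht : 0 < t) (htd : t < d + 1) :
    μH[t] {y : Sphere d | ((d - t : ℝ) : EReal) < growthExponent μ y} = 0 := by
  have := isFiniteMeasure_variation hμ
  refine hausdorffMeasure_eq_zero_of_density μ.variation ht _ fun y hy C hC => ?_
  by_contra! hcon
  obtain ⟨C', hC'⟩ := norm_poissonIntegral_radial_le htd hC.le hcon
  refine (not_lt.2 (growthExponent_le (γ := d - t) (C := C') fun s hs hs1 => ?_)) hy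
  rw [neg_sub]
  exact hC' s hs hs1

lemma dimH_levelSet_le {μ : Measures d} (hμ : μ ∈ unitBall d) {β : ℝ} (hβ : 0 ≤ β)
    (hβd : β ≤ d) : dimH (levelSet β μ) ≤ ENNReal.ofReal (d - β) := by
  -- The density argument covers exponents strictly above `d - t`, hence the loss `ε`; `ε < 1` keeps
  -- `t = d - β + ε` below `d + 1`.
  have key : ∀ ε : ℝ, 0 < ε → ε < 1 → dimH (levelSet β μ) ≤ ENNReal.ofReal (d - β + ε) := by
    intro ε hε hε1
    have h0 : 0 < d - β + ε := by linarith
    have h := hausdorffMeasure_growthExponent_gt hμ h0 (by linarith)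
    have hsub : levelSet β μ ⊆
        {y : Sphere d | ((d - (d - β + ε) : ℝ) : EReal) < growthExponent μ y} := by
      intro y hy
      have hy' : growthExponent μ y = (β : EReal) := hy
      rw [Set.mem_ofPred_eq, hy', EReal.coe_lt_coe_iff]
      linarith
    have h2 : μH[((d - β + ε).toNNReal : ℝ)] (levelSet β μ) ≠ ⊤ := by
      rw [Real.coe_toNNReal _ h0.le, measure_mono_null hsub h]
      exact ENNReal.zero_ne_top
    exact dimH_le_of_hausdorffMeasure_ne_top h2
  have hlim : Tendsto (fun ε : ℝ => ENNReal.ofReal (d - β + ε)) (𝓝[>] 0)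
      (𝓝 (ENNReal.ofReal (d - β))) := by
    have : Tendsto (fun ε : ℝ => ENNReal.ofReal (d - β + ε)) (𝓝 0)
        (𝓝 (ENNReal.ofReal (d - β + 0))) := by
      exact (ENNReal.continuous_ofReal.comp (continuous_const.add continuous_id)).tendsto 0
    rw [add_zero] at this
    exact this.mono_left nhdsWithin_le_nhds
  refine ge_of_tendsto hlim ?_
  filter_upwards [Ioo_mem_nhdsGT (zero_lt_one' ℝ)] with ε hε
  exact key ε hε.1 hε.2

/-! ### Spreading binary digits -/

/-- The integer map that spreads out the binary digits of `k`: the last `N` digits are moved to the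
positions prescribed by `q`, and zeros are inserted in between. -/
def spreadNat (q : ℕ → ℕ) : ℕ → ℕ → ℕ
  | 0, k => k
  | N + 1, k => 2 ^ (q (N + 1) - q N) * spreadNat q N (k / 2) + k % 2

/-- The shift between consecutive positions is at least one bit, so the multiplier is at least `2`
and the appended digit never causes a carry. -/
lemma spreadNat_strictMono {q : ℕ → ℕ} (hq : StrictMono q) (N : ℕ) :
    StrictMono (spreadNat q N) := by
  induction N with
  | zero => exact fun a b h => h
  | succ N ih =>
    intro a b hab
    have hgap : 2 ≤ 2 ^ (q (N + 1) - q N) := by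
      have := hq (Nat.lt_succ_self N)
      calc 2 = 2 ^ 1 := rfl
        _ ≤ _ := Nat.pow_le_pow_right (by norm_num) (by simp only [Nat.succ_eq_add_one] at this; omega)
    simp only [spreadNat]
    rcases (Nat.div_le_div_right (c := 2) hab.le).lt_or_eq with h | h
    · have h1 : spreadNat q N (a / 2) + 1 ≤ spreadNat q N (b / 2) := ih h
      have := Nat.mul_le_mul_left (2 ^ (q (N + 1) - q N)) h1
      have := Nat.mod_lt a (show 0 < 2 by norm_num)
      rw [Nat.mul_add] at *
      omega
    · rw [h]
      omega

/-- The truncation at level `N` of the digit spreading map. -/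
noncomputable def spreadApprox (q : ℕ → ℕ) (N : ℕ) (x : ℝ) : ℝ :=
  (spreadNat q N ⌊2 ^ N * x⌋₊ : ℝ) / 2 ^ q N

/-- The digit spreading map on the reals. -/
noncomputable def spread (q : ℕ → ℕ) (x : ℝ) : ℝ := ⨆ N, spreadApprox q N x

lemma floor_two_mul_div_two (z : ℝ) : ⌊2 * z⌋₊ / 2 = ⌊z⌋₊ := by
  rw [← Nat.floor_div_natCast]
  norm_num

lemma spreadApprox_succ {q : ℕ → ℕ} (hq : StrictMono q) (N : ℕ) (x : ℝ) :
    spreadApprox q (N + 1) x =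
      spreadApprox q N x + ((⌊2 ^ (N + 1) * x⌋₊ % 2 : ℕ) : ℝ) / 2 ^ q (N + 1) := by
  have hgap : q (N + 1) = (q (N + 1) - q N) + q N := by
    have := hq (Nat.lt_succ_self N)
    simp only [Nat.succ_eq_add_one] at this
    omega
  have hpow : (2 : ℝ) ^ q (N + 1) = 2 ^ (q (N + 1) - q N) * 2 ^ q N := by
    rw [← pow_add, ← hgap]
  have hfl : ⌊2 ^ (N + 1) * x⌋₊ / 2 = ⌊2 ^ N * x⌋₊ := by
    rw [pow_succ', mul_assoc, floor_two_mul_div_two]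
  unfold spreadApprox
  rw [spreadNat, hfl, hpow]
  push_cast
  field_simp

lemma spreadApprox_monotone {q : ℕ → ℕ} (hq : StrictMono q) (x : ℝ) :
    Monotone fun N => spreadApprox q N x := by
  refine monotone_nat_of_le_succ fun N => ?_
  rw [spreadApprox_succ hq]
  have : (0 : ℝ) ≤ ((⌊2 ^ (N + 1) * x⌋₊ % 2 : ℕ) : ℝ) / 2 ^ q (N + 1) := by positivity
  linarith

/-- The remaining digits sit at distinct positions after `q N`, so they contribute at most `2^(-q
N)`. Together with monotonicity this makes the intervals containing `spread q x` nested. -/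
lemma spreadApprox_add_antitone {q : ℕ → ℕ} (hq : StrictMono q) (x : ℝ) :
    Antitone fun N => spreadApprox q N x + (1 / 2) ^ q N := by
  refine antitone_nat_of_succ_le fun N => ?_
  rw [spreadApprox_succ hq]
  have h1 : ((⌊2 ^ (N + 1) * x⌋₊ % 2 : ℕ) : ℝ) ≤ 1 := by
    exact_mod_cast Nat.le_of_lt_succ (Nat.mod_lt _ (by norm_num))
  have h2 : ((⌊2 ^ (N + 1) * x⌋₊ % 2 : ℕ) : ℝ) / 2 ^ q (N + 1) ≤ (1 / 2) ^ q (N + 1) := by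
    rw [one_div, inv_pow, ← one_div]
    gcongr
  have h3 : (1 / 2 : ℝ) ^ q (N + 1) ≤ (1 / 2) ^ (q N + 1) :=
    pow_le_pow_of_le_one (by norm_num) (by norm_num) (hq (Nat.lt_succ_self N))
  rw [pow_succ] at h3
  linarith

lemma spread_mem_Icc {q : ℕ → ℕ} (hq : StrictMono q) (x : ℝ) (N : ℕ) :
    spread q x ∈ Set.Icc (spreadApprox q N x) (spreadApprox q N x + (1 / 2) ^ q N) := by
  have := Monotone.ciSup_mem_iInter_Icc_of_antitone (spreadApprox_monotone hq x)
    (spreadApprox_add_antitone hq x) (fun N => by simp)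
  exact Set.mem_iInter.1 this N

/-- Points at distance at least `2 / 2 ^ N` are mapped to points at distance at least
`1 / 2 ^ q N`. -/
lemma spread_expansion {q : ℕ → ℕ} (hq : StrictMono q) {x y : ℝ} (hx : 0 ≤ x) {N : ℕ}
    (h : 2 * (1 / 2) ^ N ≤ y - x) : (1 / 2 : ℝ) ^ q N ≤ spread q y - spread q x := by
  have hN : (0 : ℝ) < 2 ^ N := by positivity
  have h1 : (2 : ℝ) ≤ 2 ^ N * y - 2 ^ N * x := by
    have := mul_le_mul_of_nonneg_left h hN.le
    have h2 : (2 : ℝ) ^ N * (2 * (1 / 2) ^ N) = 2 := by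
      rw [mul_left_comm, ← mul_pow]; norm_num
    rw [h2] at this
    linarith
  -- Two units of separation are required, since the truncation error consumes one of them.
  have h2 : ⌊2 ^ N * x⌋₊ + 2 ≤ ⌊2 ^ N * y⌋₊ := by
    refine Nat.le_floor ?_
    have := Nat.floor_le (show 0 ≤ 2 ^ N * x by positivity)
    push_cast
    linarith
  have h3 : spreadNat q N ⌊2 ^ N * x⌋₊ + 2 ≤ spreadNat q N ⌊2 ^ N * y⌋₊ := by
    have a1 := spreadNat_strictMono hq N (Nat.lt_succ_self ⌊2 ^ N * x⌋₊)
    have a2 := spreadNat_strictMono hq N (Nat.lt_succ_self (⌊2 ^ N * x⌋₊ + 1))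
    have a3 := (spreadNat_strictMono hq N).monotone h2
    simp only [Nat.succ_eq_add_one, add_assoc, Nat.reduceAdd] at a1 a2
    omega
  have h4 : spreadApprox q N x + 2 * (1 / 2) ^ q N ≤ spreadApprox q N y := by
    unfold spreadApprox
    have : (2 : ℝ) * (1 / 2) ^ q N = 2 / 2 ^ q N := by rw [one_div, inv_pow]; ring
    rw [this, ← add_div]
    gcongr
    exact_mod_cast h3
  have h5 := (spread_mem_Icc hq x N).2
  have h6 := (spread_mem_Icc hq y N).1
  linarith

lemma spread_mem_unit {q : ℕ → ℕ} (hq : StrictMono q) (h0 : q 0 = 0) {x : ℝ}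
    (hx : x ∈ Set.Ico (0 : ℝ) 1) : spread q x ∈ Set.Icc (0 : ℝ) 1 := by
  have h := spread_mem_Icc hq x 0
  have : spreadApprox q 0 x = 0 := by
    simp [spreadApprox, spreadNat, Nat.floor_eq_zero.2 hx.2]
  simpa [this, h0] using h

/-- The image of the digit spreading map is close to dyadic points of level `q N`. -/
lemma exists_spread_near_dyadic {q : ℕ → ℕ} (hq : StrictMono q) (h0 : q 0 = 0) {x : ℝ}
    (hx : x ∈ Set.Ico (0 : ℝ) 1) (N : ℕ) :
    ∃ k : ℕ, k < 2 ^ q N ∧ |spread q x - k / 2 ^ q N| ≤ 2 * (1 / 2) ^ q (N + 1) := by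
  refine ⟨spreadNat q N ⌊2 ^ N * x⌋₊, ?_, ?_⟩
  · have h := spreadApprox_add_antitone hq x (Nat.zero_le N)
    have h00 : spreadApprox q 0 x = 0 := by
      simp [spreadApprox, spreadNat, Nat.floor_eq_zero.2 hx.2]
    simp only [h00, h0, pow_zero, zero_add] at h
    have hpos : (0 : ℝ) < (1 / 2) ^ q N := by positivity
    have h1 : spreadApprox q N x < 1 := by linarith
    unfold spreadApprox at h1
    rw [div_lt_one (by positivity)] at h1
    exact_mod_cast h1
  · have h1 := (spread_mem_Icc hq x N).1
    have h2 := (spread_mem_Icc hq x (N + 1)).2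
    rw [spreadApprox_succ hq] at h2
    have h3 : ((⌊2 ^ (N + 1) * x⌋₊ % 2 : ℕ) : ℝ) / 2 ^ q (N + 1) ≤ (1 / 2) ^ q (N + 1) := by
      rw [one_div, inv_pow, ← one_div]
      gcongr
      exact_mod_cast Nat.le_of_lt_succ (Nat.mod_lt _ (by norm_num))
    have e : (spreadNat q N ⌊2 ^ N * x⌋₊ : ℝ) / 2 ^ q N = spreadApprox q N x := rfl
    rw [e, abs_of_nonneg (by linarith)]
    linarith

/-- If `q N ≤ α N` then the inverse of the digit spreading map is Hölder of exponent `1 / α`. -/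
lemma abs_sub_le_spread {q : ℕ → ℕ} (hq : StrictMono q) {α : ℝ} (hα : 1 ≤ α)
    (hqα : ∀ N, (q N : ℝ) ≤ α * N) {x y : ℝ} (hx : x ∈ Set.Ico (0 : ℝ) 1)
    (hy : y ∈ Set.Ico (0 : ℝ) 1) : |x - y| ≤ 4 * |spread q x - spread q y| ^ (1 / α) := by
  wlog hxy : x < y generalizing x y
  · rcases (not_lt.1 hxy).lt_or_eq with h | h
    · rw [abs_sub_comm, abs_sub_comm (spread q x)]
      exact this hy hx h
    · rw [h]; simp; positivity
  have hα0 : 0 < α := by linarith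
  -- The least such level is not `0` since `y - x < 1`. Minimality then bounds `y - x` by `4 ·
  -- 2^(-(N+1))`, the source of the factor `4`.
  have hex : ∃ N : ℕ, 2 * (1 / 2 : ℝ) ^ N ≤ y - x := by
    obtain ⟨N, hN⟩ := exists_pow_lt_of_lt_one (show 0 < (y - x) / 2 by linarith)
      (show (1 / 2 : ℝ) < 1 by norm_num)
    exact ⟨N, by linarith⟩
  classical
  have hspec := Nat.find_spec hex
  rcases hn : Nat.find hex with _ | N
  · rw [hn] at hspec
    have := hx.1; have := hy.2
    norm_num at hspec
    linarith
  · have hmin := Nat.find_min hex (m := N) (by omega)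
    rw [hn] at hspec
    have h1 := spread_expansion hq hx.1 hspec
    have h2 : (1 / 2 : ℝ) ^ (N + 1) ≤ (spread q y - spread q x) ^ (1 / α) := by
      calc (1 / 2 : ℝ) ^ (N + 1) = ((1 / 2 : ℝ) ^ (α * (N + 1 : ℕ))) ^ (1 / α) := by
            rw [← Real.rpow_mul (by norm_num), mul_one_div, mul_div_cancel_left₀ _ hα0.ne',
              Real.rpow_natCast]
        _ ≤ ((1 / 2 : ℝ) ^ ((q (N + 1) : ℕ) : ℝ)) ^ (1 / α) := by
            refine Real.rpow_le_rpow (by positivity) ?_ (by positivity)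
            exact Real.rpow_le_rpow_of_exponent_ge (by norm_num) (by norm_num) (hqα (N + 1))
        _ ≤ _ := by
            rw [Real.rpow_natCast]
            exact Real.rpow_le_rpow (by positivity) h1 (by positivity)
    have hpos : 0 ≤ spread q y - spread q x := le_trans (by positivity) h1
    rw [abs_sub_comm, abs_of_pos (by linarith), abs_sub_comm (spread q x), abs_of_nonneg hpos]
    rw [not_le] at hmin
    rw [pow_succ] at h2
    linarith

/-! ### Choice of the digit positions -/

section gaps

variable (J : Set ℕ) (α : ℝ)

open Classical in
/-- The digit positions: a jump from about `n` to about `α n` occurs at those `n ∈ J` before which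
few positions have been skipped. -/
noncomputable def jumpSeq : ℕ → ℕ
  | 0 => 0
  | N + 1 => if jumpSeq N ∈ J ∧ (jumpSeq N - N) ^ 2 ≤ N then ⌊α * (N + 1)⌋₊ else jumpSeq N + 1

variable {α}

lemma jumpSeq_le (hα : 1 ≤ α) (N : ℕ) : (jumpSeq J α N : ℝ) ≤ α * N := by
  induction N with
  | zero => simp [jumpSeq]
  | succ N ih =>
    simp only [jumpSeq]
    split_ifs
    · push_cast
      exact Nat.floor_le (by positivity)
    · push_cast
      linarith

lemma jumpSeq_strictMono (hα : 1 ≤ α) : StrictMono (jumpSeq J α) := by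
  refine strictMono_nat_of_lt_succ fun N => ?_
  have h := jumpSeq_le J hα N
  rw [jumpSeq]
  split_ifs
  · refine Nat.lt_of_succ_le (Nat.le_floor ?_)
    push_cast
    linarith
  · exact Nat.lt_succ_self _

/-- Without jumps after `N₀` the positions increase by one, so every later integer is a position and
the number of skipped positions stays constant. A large enough element of `J` then meets both jump
conditions. -/
lemma frequently_jump (hα : 1 ≤ α) (hJ : ∃ᶠ n in atTop, n ∈ J) :
    ∃ᶠ N in atTop, jumpSeq J α N ∈ J ∧ (jumpSeq J α N - N) ^ 2 ≤ N := by
  rw [Filter.Frequently, eventually_atTop]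
  rintro ⟨N₀, hN₀⟩
  have hle : ∀ N, N ≤ jumpSeq J α N := (jumpSeq_strictMono J hα).id_le
  have hstep : ∀ i, jumpSeq J α (N₀ + i) = jumpSeq J α N₀ + i := by
    intro i
    induction i with
    | zero => rfl
    | succ i ih =>
      rw [← add_assoc, jumpSeq, if_neg (hN₀ _ (Nat.le_add_right _ _)), ih]
      rfl
  obtain ⟨n, hn, hnJ⟩ := frequently_atTop.1 hJ
    (jumpSeq J α N₀ + (jumpSeq J α N₀ - N₀) ^ 2)
  have hi := hstep (n - jumpSeq J α N₀)
  have h0 := hle N₀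
  rw [Nat.add_sub_cancel' (by omega)] at hi
  refine hN₀ (N₀ + (n - jumpSeq J α N₀)) (Nat.le_add_right _ _) ⟨by rwa [hi], ?_⟩
  rw [hi]
  have e : n - (N₀ + (n - jumpSeq J α N₀)) = jumpSeq J α N₀ - N₀ := by omega
  rw [e]
  omega

end gaps

/-! ### A bi-Lipschitz chart of the sphere -/

/-- The unit cube of `ℝ^d` embeds in the sphere by a bi-Lipschitz map. -/
lemma exists_bilipschitz_chart (d : ℕ) : ∃ φ : (Fin d → ℝ) → Sphere d, ∃ K : ℝ, 1 ≤ K ∧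
    (∀ u v, dist (φ u) (φ v) ≤ K * dist u v) ∧
    ∀ u ∈ Set.Icc (0 : Fin d → ℝ) 1, ∀ v ∈ Set.Icc (0 : Fin d → ℝ) 1,
      dist u v ≤ K * dist (φ u) (φ v) := by
  -- The chart is the central projection of the affine hyperplane `x₀ = 1`.
  let L : (Fin d → ℝ) → EuclideanSpace ℝ (Fin (d + 1)) := fun u => WithLp.toLp 2 (Fin.cons 1 u)
  have hL0 : ∀ u, L u 0 = 1 := fun u => rfl
  have hLs : ∀ u i, L u (Fin.succ i) = u i := fun u i => rfl
  have hd : (0 : ℝ) ≤ d := Nat.cast_nonneg d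
  have hLsq : ∀ u, ‖L u‖ ^ 2 = 1 + ∑ i, u i ^ 2 := fun u => by
    rw [EuclideanSpace.real_norm_sq_eq, Fin.sum_univ_succ]
    simp [hL0, hLs]
  have hL1 : ∀ u, 1 ≤ ‖L u‖ := fun u => by
    have : 0 ≤ ∑ i, u i ^ 2 := Finset.sum_nonneg fun i _ => sq_nonneg _
    nlinarith [hLsq u, norm_nonneg (L u)]
  have hLpos : ∀ u, 0 < ‖L u‖ := fun u => one_pos.trans_le (hL1 u)
  have hLd : ∀ u ∈ Set.Icc (0 : Fin d → ℝ) 1, ‖L u‖ ≤ d + 1 := fun u hu => by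
    have : ∑ i, u i ^ 2 ≤ ∑ _i : Fin d, (1 : ℝ) := Finset.sum_le_sum fun i _ => by
      have h0 : 0 ≤ u i := hu.1 i
      have h1 : u i ≤ 1 := hu.2 i
      nlinarith
    simp only [Finset.sum_const, Finset.card_univ, Fintype.card_fin, nsmul_eq_mul, mul_one] at this
    refine abs_le_of_sq_le_sq' ?_ (by positivity) |>.2
    nlinarith [hLsq u]
  have hLlip : ∀ u v, ‖L u - L v‖ ≤ (d + 1) * dist u v := fun u v => by
    have h1 : ‖L u - L v‖ ^ 2 = ∑ i, (u i - v i) ^ 2 := by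
      rw [EuclideanSpace.real_norm_sq_eq, Fin.sum_univ_succ]
      simp [hL0, hLs]
    have h2 : ∑ i, (u i - v i) ^ 2 ≤ ∑ _i : Fin d, dist u v ^ 2 := Finset.sum_le_sum fun i _ => by
      rw [← sq_abs, ← Real.dist_eq]
      gcongr
      exact dist_le_pi_dist u v i
    simp only [Finset.sum_const, Finset.card_univ, Fintype.card_fin, nsmul_eq_mul] at h2
    refine abs_le_of_sq_le_sq' ?_ (by positivity) |>.2
    rw [h1, mul_pow]
    refine h2.trans ?_
    gcongr
    nlinarith
  let φ : (Fin d → ℝ) → Sphere d := fun u => ⟨‖L u‖⁻¹ • L u, by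
    rw [mem_sphere_zero_iff_norm, norm_smul, norm_inv, norm_norm, inv_mul_cancel₀ (hLpos u).ne']⟩
  have hφ : ∀ u, (φ u : EuclideanSpace ℝ (Fin (d + 1))) = ‖L u‖⁻¹ • L u := fun u => rfl
  refine ⟨φ, 2 * (d + 1) ^ 2, by nlinarith, fun u v => ?_, fun u hu v hv => ?_⟩
  · have h1 : dist (φ u) (φ v) ≤ 2 * ‖L u - L v‖ := by
      rw [Subtype.dist_eq, dist_eq_norm, hφ, hφ]
      have e : ‖L u‖⁻¹ • L u - ‖L v‖⁻¹ • L v =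
          ‖L u‖⁻¹ • (L u - L v) + (‖L u‖⁻¹ - ‖L v‖⁻¹) • L v := by
        rw [smul_sub, sub_smul]; abel
      rw [e]
      refine (norm_add_le _ _).trans ?_
      rw [norm_smul, norm_smul, norm_inv, norm_norm, Real.norm_eq_abs]
      have h3 : |‖L u‖⁻¹ - ‖L v‖⁻¹| * ‖L v‖ = ‖L u‖⁻¹ * |‖L v‖ - ‖L u‖| := by
        rw [inv_sub_inv (hLpos u).ne' (hLpos v).ne', abs_div, abs_of_pos (mul_pos (hLpos u) (hLpos v))]
        field_simp [(hLpos u).ne', (hLpos v).ne']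
      have h4 : |‖L v‖ - ‖L u‖| ≤ ‖L u - L v‖ := by
        rw [norm_sub_rev]; exact abs_norm_sub_norm_le _ _
      have h5 : ‖L u‖⁻¹ ≤ 1 := inv_le_one_of_one_le₀ (hL1 u)
      rw [h3]
      have := mul_le_mul h5 h4 (abs_nonneg _) zero_le_one
      have := mul_le_mul_of_nonneg_right h5 (norm_nonneg (L u - L v))
      linarith
    have h2 := hLlip u v
    have h3 : (d + 1) * dist u v ≤ (d + 1) ^ 2 * dist u v := by
      gcongr; nlinarith
    linarith
  · set D := dist (φ u) (φ v) with hD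
    have hD0 : 0 ≤ D := dist_nonneg
    have hcoord : ∀ j, |(φ u : EuclideanSpace ℝ (Fin (d + 1))) j -
        (φ v : EuclideanSpace ℝ (Fin (d + 1))) j| ≤ D := fun j => by
      rw [hD, Subtype.dist_eq, dist_eq_norm]
      exact PiLp.norm_apply_le ((φ u).1 - (φ v).1) j
    have hone : ∀ j, |(φ v : EuclideanSpace ℝ (Fin (d + 1))) j| ≤ 1 := fun j =>
      (PiLp.norm_apply_le (φ v).1 j).trans_eq (norm_eq_of_mem_sphere (φ v))
    refine (dist_pi_le_iff (by positivity)).2 fun i => ?_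
    rw [Real.dist_eq]
    have hu' : u i = ‖L u‖ * (φ u : EuclideanSpace ℝ (Fin (d + 1))) i.succ := by
      rw [hφ, PiLp.smul_apply, hLs, smul_eq_mul, mul_inv_cancel_left₀ (hLpos u).ne']
    have hv' : v i = ‖L v‖ * (φ v : EuclideanSpace ℝ (Fin (d + 1))) i.succ := by
      rw [hφ, PiLp.smul_apply, hLs, smul_eq_mul, mul_inv_cancel_left₀ (hLpos v).ne']
    -- The coordinate of index `0` of `φ u` is `1 / ‖L u‖`, so the chart itself controls the
    -- normalising factor.
    have hdiff : ‖L u‖ - ‖L v‖ = ‖L u‖ * ‖L v‖ * ((φ v : EuclideanSpace ℝ (Fin (d + 1))) 0 -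
        (φ u : EuclideanSpace ℝ (Fin (d + 1))) 0) := by
      rw [hφ, hφ, PiLp.smul_apply, PiLp.smul_apply, hL0, hL0, smul_eq_mul, smul_eq_mul]
      field_simp [(hLpos u).ne', (hLpos v).ne']
    have h1 : |‖L u‖ - ‖L v‖| ≤ (d + 1) * (d + 1) * D := by
      rw [hdiff, abs_mul, abs_of_pos (mul_pos (hLpos u) (hLpos v)), abs_sub_comm]
      gcongr
      · exact hLd u hu
      · exact hLd v hv
      · exact hcoord 0
    have e : u i - v i = ‖L u‖ * ((φ u : EuclideanSpace ℝ (Fin (d + 1))) i.succ -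
        (φ v : EuclideanSpace ℝ (Fin (d + 1))) i.succ) +
        (‖L u‖ - ‖L v‖) * (φ v : EuclideanSpace ℝ (Fin (d + 1))) i.succ := by
      rw [hu', hv']; ring
    rw [e]
    refine (abs_add_le _ _).trans ?_
    rw [abs_mul, abs_mul, abs_of_pos (hLpos u)]
    have h2 := mul_le_mul (hLd u hu) (hcoord i.succ) (abs_nonneg _) (by positivity)
    have h3 := mul_le_mul h1 (hone i.succ) (abs_nonneg _) (by positivity)
    nlinarith [mul_nonneg hd hD0]

/-! ### Discretization and grid perturbations -/

/-- A measure in the unit ball is approximated, on functions of small oscillation at scale `δ`, by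
finite sums of Dirac masses of total mass at most one. -/
lemma exists_discretization {μ : Measures d} (hμ : μ ∈ unitBall d) {δ : ℝ} (hδ : 0 < δ) :
    ∃ (m : ℕ) (x : Fin m → Sphere d) (c : Fin m → ℂ), ∑ i, ‖c i‖ ≤ 1 ∧
      ∀ (g : Sphere d → ℂ) (η : ℝ), Continuous g → 0 ≤ η →
        (∀ a b, dist a b < δ → ‖g a - g b‖ ≤ η) → ‖∑ i, g (x i) * c i - pairing μ g‖ ≤ η := by
  have := isFiniteMeasure_variation hμ
  obtain ⟨T, -, hT, hcov⟩ := finite_cover_balls_of_compact (isCompact_univ (X := Sphere d)) hδ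
  obtain ⟨m, x, hx⟩ : ∃ (m : ℕ) (x : Fin m → Sphere d), Set.range x = T := by
    obtain ⟨m, f, hf⟩ := hT.fin_param
    exact ⟨m, f, hf.2⟩
  let A : Fin m → Set (Sphere d) := disjointed fun i => Metric.ball (x i) δ
  have hAmeas : ∀ i, MeasurableSet (A i) := fun i => by
    simp only [A, disjointed_apply, Finset.sup_set_eq_biUnion]
    exact Metric.isOpen_ball.measurableSet.diff
      (Finset.measurableSet_biUnion _ fun _ _ => Metric.isOpen_ball.measurableSet)
  have hAsub : ∀ i, A i ⊆ Metric.ball (x i) δ := fun i => disjointed_subset _ i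
  have hAdisj : Pairwise (Function.onFun Disjoint A) := disjoint_disjointed _
  have hAcov : ⋃ i, A i = Set.univ := by
    rw [iUnion_disjointed, Set.eq_univ_iff_forall]
    intro ξ
    obtain ⟨z, hz, hξ⟩ := Set.mem_iUnion₂.1 (hcov (Set.mem_univ ξ))
    rw [← hx] at hz
    obtain ⟨i, rfl⟩ := hz
    exact Set.mem_iUnion.2 ⟨i, hξ⟩
  -- The atoms are the centres of a finite cover, weighted by the mass of the associated pieces of a
  -- partition. They are chosen before `g`, so the estimate is uniform over test functions.
  refine ⟨m, x, fun i => μ (A i), ?_, fun g η hg hη hosc => ?_⟩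
  · have h1 : ∑ i, ‖μ (A i)‖ₑ ≤ 1 := by
      calc ∑ i, ‖μ (A i)‖ₑ ≤ ∑ i, μ.variation (A i) :=
            Finset.sum_le_sum fun i _ => VectorMeasure.enorm_measure_le_variation μ (A i)
        _ = μ.variation (⋃ i, A i) := by
            rw [measure_iUnion hAdisj hAmeas, tsum_fintype]
        _ ≤ 1 := by rw [hAcov]; exact hμ
    have h2 : ∑ i, ‖μ (A i)‖ₑ = ENNReal.ofReal (∑ i, ‖μ (A i)‖) := by
      rw [ENNReal.ofReal_sum_of_nonneg fun i _ => norm_nonneg _]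
      simp_rw [ofReal_norm]
    rw [h2] at h1
    exact ENNReal.ofReal_le_one.1 h1
  · let h : Sphere d → ℂ := fun ξ => ∑ i, (A i).indicator (fun _ => g (x i)) ξ
    have hint : ∀ i, VectorMeasure.Integrable μ ((A i).indicator fun _ => g (x i)) := fun i =>
      (integrable_const (g (x i))).indicator (hAmeas i)
    have hpair : pairing μ h = ∑ i, g (x i) * μ (A i) := by
      unfold pairing
      rw [VectorMeasure.integral_finsetSum _ fun i _ => hint i]
      refine Finset.sum_congr rfl fun i _ => ?_
      have : IsFiniteMeasure (VectorMeasure.variation (μ.restrict (A i))) :=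
        isFiniteMeasure_of_le _ (VectorMeasure.variation_restrict_le.trans Measure.restrict_le_self)
      rw [VectorMeasure.integral_indicator (hAmeas i), VectorMeasure.integral_const,
        VectorMeasure.restrict_apply _ (hAmeas i) MeasurableSet.univ, Set.univ_inter]
      rfl
    have hsub : pairing μ (fun ξ => h ξ - g ξ) = pairing μ h - pairing μ g :=
      VectorMeasure.integral_fun_sub (VectorMeasure.Integrable.fun_finsetSum _ fun i _ => hint i)
        (integrable_of_continuous hg)
    rw [← hpair, ← hsub]
    refine norm_pairing_le hμ hη fun ξ => ?_
    obtain ⟨i, hi⟩ := Set.mem_iUnion.1 (hAcov ▸ Set.mem_univ ξ : ξ ∈ ⋃ i, A i)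
    have hval : h ξ = g (x i) := by
      refine (Finset.sum_eq_single i (fun j _ hj => ?_) (by simp)).trans
        (Set.indicator_of_mem hi _)
      exact Set.indicator_of_notMem (fun hj' => Set.disjoint_left.1 (hAdisj hj) hj' hi) _
    rw [hval]
    refine hosc _ _ ?_
    rw [dist_comm]
    exact hAsub i hi

/-- The dyadic point of the unit cube with numerators `k` at level `n`. -/
noncomputable def dyadicPoint (n : ℕ) (k : Fin d → ℕ) : Fin d → ℝ := fun i => k i / 2 ^ n

/-- Shrinks `∑ i, c i • δ_{x i}` by the factor `1 - 1 / n` and adds mass `1 / n`, uniformly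
distributed over the image under `φ` of the dyadic grid of level `n`. -/
noncomputable def gridPerturb (φ : (Fin d → ℝ) → Sphere d) (n : ℕ) {m : ℕ} (x : Fin m → Sphere d)
    (c : Fin m → ℂ) : Measures d :=
  diracSum (Finset.univ : Finset (Fin m ⊕ (Fin d → Fin (2 ^ n))))
    (Sum.elim x fun k => φ (dyadicPoint n fun i => k i))
    (Sum.elim (fun i => ((1 - 1 / n : ℝ) : ℂ) * c i)
      fun _ => ((1 / (n * (2 ^ n) ^ d) : ℝ) : ℂ))

section gridPerturb

variable (φ : (Fin d → ℝ) → Sphere d) {n : ℕ} (hn : 1 ≤ n) {m : ℕ} (x : Fin m → Sphere d)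
  {c : Fin m → ℂ} (hc : ∑ i, ‖c i‖ ≤ 1)

include hn in
lemma sum_grid_weights : ∑ _k : Fin d → Fin (2 ^ n), (1 / (n * (2 ^ n) ^ d) : ℝ) = 1 / n := by
  have : (0 : ℝ) < n := by exact_mod_cast hn
  simp only [Finset.sum_const, Finset.card_univ, Fintype.card_pi, Fintype.card_fin,
    Finset.prod_const, nsmul_eq_mul]
  push_cast
  field_simp

include hn hc in
lemma gridPerturb_mem_unitBall : gridPerturb φ n x c ∈ unitBall d := by
  have hn0 : (0 : ℝ) < n := by exact_mod_cast hn
  have hn1 : (1 / n : ℝ) ≤ 1 := by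
    rw [div_le_one hn0]; exact_mod_cast hn
  refine (diracSum_variation_le _ _ _).trans ?_
  have h : ∀ z : Fin m ⊕ (Fin d → Fin (2 ^ n)), ‖Sum.elim (fun i => ((1 - 1 / n : ℝ) : ℂ) * c i)
      (fun _ => ((1 / (n * (2 ^ n) ^ d) : ℝ) : ℂ)) z‖ₑ =
      ENNReal.ofReal (Sum.elim (fun i => (1 - 1 / n : ℝ) * ‖c i‖)
        (fun _ => (1 / (n * (2 ^ n) ^ d) : ℝ)) z) := by
    rintro (i | k)
    · rw [← ofReal_norm, Sum.elim_inl, Sum.elim_inl, norm_mul, Complex.norm_real,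
        Real.norm_of_nonneg (by linarith)]
    · rw [← ofReal_norm, Sum.elim_inr, Sum.elim_inr, Complex.norm_real,
        Real.norm_of_nonneg (by positivity)]
  rw [Finset.sum_congr rfl fun z _ => h z, ← ENNReal.ofReal_sum_of_nonneg]
  · rw [Fintype.sum_sum_type]
    simp only [Sum.elim_inl, Sum.elim_inr]
    rw [sum_grid_weights hn, ← Finset.mul_sum, ENNReal.ofReal_le_one]
    have := mul_le_mul_of_nonneg_left hc (show 0 ≤ 1 - 1 / (n : ℝ) by linarith)
    linarith
  · rintro (i | k) -
    · exact mul_nonneg (by linarith) (norm_nonneg _)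
    · simp only [Sum.elim_inr]; positivity

include hn hc in
lemma norm_pairing_gridPerturb_sub_le {g : Sphere d → ℂ} (hg : Continuous g) {B : ℝ}
    (hB : 0 ≤ B) (hgB : ∀ ξ, ‖g ξ‖ ≤ B) :
    ‖pairing (gridPerturb φ n x c) g - ∑ i, g (x i) * c i‖ ≤ 2 * B / n := by
  have hn0 : (0 : ℝ) < n := by exact_mod_cast hn
  unfold gridPerturb
  rw [pairing_diracSum _ _ _ hg, Fintype.sum_sum_type]
  simp only [Sum.elim_inl, Sum.elim_inr]
  have e : ∑ i, g (x i) * (((1 - 1 / n : ℝ) : ℂ) * c i) +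
      ∑ k : Fin d → Fin (2 ^ n), g (φ (dyadicPoint n fun i => k i)) *
        ((1 / (n * (2 ^ n) ^ d) : ℝ) : ℂ) - ∑ i, g (x i) * c i =
      ∑ k : Fin d → Fin (2 ^ n), g (φ (dyadicPoint n fun i => k i)) *
        ((1 / (n * (2 ^ n) ^ d) : ℝ) : ℂ) - ((1 / n : ℝ) : ℂ) * ∑ i, g (x i) * c i := by
    have e1 : ∑ i, g (x i) * (((1 - 1 / n : ℝ) : ℂ) * c i) =
        ∑ i, g (x i) * c i - ((1 / n : ℝ) : ℂ) * ∑ i, g (x i) * c i := by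
      rw [Finset.mul_sum, ← Finset.sum_sub_distrib]
      refine Finset.sum_congr rfl fun i _ => ?_
      push_cast; ring
    rw [e1]; ring
  rw [e]
  have h1 : ‖∑ k : Fin d → Fin (2 ^ n), g (φ (dyadicPoint n fun i => k i)) *
      ((1 / (n * (2 ^ n) ^ d) : ℝ) : ℂ)‖ ≤ B * (1 / n) := by
    refine (norm_sum_le _ _).trans ?_
    rw [← sum_grid_weights (d := d) hn, Finset.mul_sum]
    refine Finset.sum_le_sum fun k _ => ?_
    rw [norm_mul, Complex.norm_real, Real.norm_of_nonneg (by positivity)]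
    gcongr
    exact hgB _
  have h2 : ‖∑ i, g (x i) * c i‖ ≤ B := by
    refine (norm_sum_le _ _).trans ?_
    calc ∑ i, ‖g (x i) * c i‖ ≤ ∑ i, B * ‖c i‖ := Finset.sum_le_sum fun i _ => by
          rw [norm_mul]; gcongr; exact hgB _
      _ = B * ∑ i, ‖c i‖ := by rw [Finset.mul_sum]
      _ ≤ B * 1 := by gcongr
      _ = B := mul_one B
  refine (norm_sub_le _ _).trans ?_
  rw [norm_mul, Complex.norm_real, Real.norm_of_nonneg (by positivity)]
  have h3 := mul_le_mul_of_nonneg_left h2 (show (0 : ℝ) ≤ 1 / n by positivity)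
  have e2 : 2 * B / n = B * (1 / n) + 1 / n * B := by ring
  rw [e2]
  exact add_le_add h1 h3

/-- The constant in the lower bound of the Poisson integral near grid points. -/
noncomputable def lowerConst (d : ℕ) (a : ℝ) : ℝ := 1 / (3 * (a + 1) ^ (d + 1))

lemma lowerConst_pos {a : ℝ} (ha : 0 ≤ a) : 0 < lowerConst d a := by
  unfold lowerConst; positivity

include hn hc in
lemma norm_poissonIntegral_gridPerturb_ge {a : ℝ} (ha : 0 ≤ a)
    (hlarge : (2 * n : ℝ) ^ (d + 1) * 2 * n * (1 / 2) ^ n ≤ lowerConst d a)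
    {y : Sphere d} (hy : ∀ i, 1 / (n : ℝ) ≤ dist y (x i)) {t : ℕ} (hnt : n ≤ t)
    {k : Fin d → ℕ} (hk : ∀ i, k i < 2 ^ n)
    (hyk : dist y (φ (dyadicPoint n k)) ≤ a * (1 / 2) ^ t) :
    2 * (lowerConst d a * 2 ^ (d * (t - n)) / n) ≤
      ‖poissonIntegral (gridPerturb φ n x c)
        ((1 - (1 / 2) ^ t : ℝ) • (y : EuclideanSpace ℝ (Fin (d + 1))))‖ := by
  have hn0 : (0 : ℝ) < n := by exact_mod_cast hn
  have hn1 : (1 / n : ℝ) ≤ 1 := by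
    rw [div_le_one hn0]; exact_mod_cast hn
  set s : ℝ := (1 / 2) ^ t with hs
  have hs0 : 0 < s := by positivity
  have hs1 : s < 1 := pow_lt_one₀ (by norm_num) (by norm_num) (by omega)
  set z : EuclideanSpace ℝ (Fin (d + 1)) := (1 - s) • (y : EuclideanSpace ℝ (Fin (d + 1))) with hz
  have hz1 : ‖z‖ < 1 := by rw [hz, norm_smul_sphere y (by linarith)]; linarith
  have hLc := lowerConst_pos (d := d) ha
  -- The `1/3` in `lowerConst` splits the contribution of one grid point in three: one share
  -- compensates the atoms `x i`, one is kept for passing to nearby measures, one is the final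
  -- bound. The other grid points only help, by positivity.
  have hmain : 3 * (lowerConst d a * 2 ^ (d * (t - n)) / n) ≤
      ∑ k : Fin d → Fin (2 ^ n), kernel z (φ (dyadicPoint n fun i => k i)) *
        (1 / (n * (2 ^ n) ^ d)) := by
    have hsingle := Finset.single_le_sum (s := (Finset.univ : Finset (Fin d → Fin (2 ^ n))))
      (f := fun k => kernel z (φ (dyadicPoint n fun i => k i)) * (1 / (n * (2 ^ n) ^ d)))
      (fun k _ => mul_nonneg (kernel_pos hz1 _).le (by positivity))
      (Finset.mem_univ fun i => (⟨k i, hk i⟩ : Fin (2 ^ n)))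
    refine le_trans ?_ hsingle
    have hker := le_kernel_radial hs0 hs1 y (φ (dyadicPoint n k)) hyk
    refine le_trans (le_of_eq ?_) (mul_le_mul_of_nonneg_right hker (by positivity))
    have e1 : (2 : ℝ) ^ (d * (t - n)) * (2 ^ n) ^ d * s ^ d = 1 := by
      rw [pow_mul', ← mul_pow, ← mul_pow, ← pow_add, Nat.sub_add_cancel hnt, hs, ← mul_pow]
      norm_num
    unfold lowerConst
    rw [mul_pow, pow_succ s d]
    field_simp
    linear_combination e1
  have hsmall : ‖∑ i, (kernel z (x i) : ℂ) * (((1 - 1 / n : ℝ) : ℂ) * c i)‖ ≤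
      lowerConst d a * 2 ^ (d * (t - n)) / n := by
    have hk : ∀ i, kernel z (x i) ≤ lowerConst d a / n := fun i => by
      have h1 := kernel_radial_le hs0 hs1.le (a := 1 / (2 * n)) (by positivity) y (x i)
        (Or.inr (by have := hy i; rw [one_div, mul_inv, ← one_div (n : ℝ)]; linarith))
      refine h1.trans ?_
      rw [le_div_iff₀ hn0]
      refine le_trans (le_of_eq ?_) ((mul_le_mul_of_nonneg_left (pow_le_pow_of_le_one
        (by norm_num) (by norm_num) hnt : (1 / 2 : ℝ) ^ t ≤ (1 / 2) ^ n)
        (show 0 ≤ (2 * n : ℝ) ^ (d + 1) * 2 * n by positivity)).trans hlarge)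
      rw [one_div (2 * (n : ℝ)), inv_pow, ← hs]
      field_simp
    calc _ ≤ ∑ i, lowerConst d a / n * ‖c i‖ := by
          refine (norm_sum_le _ _).trans (Finset.sum_le_sum fun i _ => ?_)
          rw [norm_mul, norm_mul, Complex.norm_real, Complex.norm_real,
            Real.norm_of_nonneg (kernel_pos hz1 _).le, Real.norm_of_nonneg (by linarith)]
          refine mul_le_mul (hk i) ?_ (by have : 0 ≤ 1 - 1 / (n : ℝ) := by linarith
                                          positivity) (by positivity)
          have : 0 ≤ 1 / (n : ℝ) := by positivity
          nlinarith [norm_nonneg (c i)]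
      _ = lowerConst d a / n * ∑ i, ‖c i‖ := by rw [Finset.mul_sum]
      _ ≤ lowerConst d a / n * 1 := by gcongr
      _ = lowerConst d a * 1 / n := by ring
      _ ≤ _ := by
          gcongr
          exact one_le_pow₀ one_le_two
  unfold gridPerturb
  rw [poissonIntegral_diracSum _ _ _ hz1, Fintype.sum_sum_type]
  simp only [Sum.elim_inl, Sum.elim_inr]
  have e : ∑ k : Fin d → Fin (2 ^ n), (kernel z (φ (dyadicPoint n fun i => k i)) : ℂ) *
      ((1 / (n * (2 ^ n) ^ d) : ℝ) : ℂ) = ((∑ k : Fin d → Fin (2 ^ n),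
        kernel z (φ (dyadicPoint n fun i => k i)) * (1 / (n * (2 ^ n) ^ d)) : ℝ) : ℂ) := by
    push_cast; rfl
  rw [e, add_comm]
  refine le_trans ?_ (norm_sub_le_norm_add _ _)
  rw [Complex.norm_real]
  have := Real.le_norm_self (∑ k : Fin d → Fin (2 ^ n),
    kernel z (φ (dyadicPoint n fun i => k i)) * (1 / (n * (2 ^ n) ^ d)))
  linarith

end gridPerturb

/-! ### Large values of generic Poisson integrals -/

/-- At scales between `2 ^ (-n ^ 2)` and `2 ^ (-n)`, the Poisson integral of `μ` is large near the
dyadic grid of level `n`, away from a small finite set. -/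
def HasLargeValues (φ : (Fin d → ℝ) → Sphere d) (a : ℝ) (μ : Measures d) (n : ℕ) : Prop :=
  ∃ F : Finset (Sphere d), (F.card : ℝ) ≤ Real.log n ∧ ∀ y : Sphere d,
    (∀ ξ ∈ F, 1 / (n : ℝ) ≤ dist y ξ) → ∀ t : ℕ, n ≤ t → t ≤ n ^ 2 → ∀ k : Fin d → ℕ,
      (∀ i, k i < 2 ^ n) → dist y (φ (dyadicPoint n k)) ≤ a * (1 / 2) ^ t →
        lowerConst d a * 2 ^ (d * (t - n)) / n ≤ ‖poissonIntegral μ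
          ((1 - (1 / 2) ^ t : ℝ) • (y : EuclideanSpace ℝ (Fin (d + 1))))‖

lemma hasLargeValues_of_near (φ : (Fin d → ℝ) → Sphere d) {n : ℕ} (hn : 1 ≤ n) {m : ℕ}
    (x : Fin m → Sphere d) {c : Fin m → ℂ} (hc : ∑ i, ‖c i‖ ≤ 1) {a : ℝ} (ha : 0 ≤ a)
    (hlarge : (2 * n : ℝ) ^ (d + 1) * 2 * n * (1 / 2) ^ n ≤ lowerConst d a)
    (hm : (m : ℝ) ≤ Real.log n) {μ : Measures d}
    (hμ : ∀ z : EuclideanSpace ℝ (Fin (d + 1)), ‖z‖ ≤ 1 - (1 / 2) ^ (n ^ 2) →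
      ‖poissonIntegral μ z - poissonIntegral (gridPerturb φ n x c) z‖ < lowerConst d a / n) :
    HasLargeValues φ a μ n := by
  classical
  refine ⟨Finset.univ.image x, ?_, fun y hy t hnt htn k hk hyk => ?_⟩
  · refine le_trans ?_ hm
    exact_mod_cast Finset.card_image_le.trans (by simp)
  · have h1 := norm_poissonIntegral_gridPerturb_ge φ hn x hc ha hlarge
      (fun i => hy (x i) (by simp)) hnt hk hyk
    have ht : (1 / 2 : ℝ) ^ t ≤ 1 := pow_le_one₀ (by norm_num) (by norm_num)
    have h2 := hμ ((1 - (1 / 2) ^ t : ℝ) • (y : EuclideanSpace ℝ (Fin (d + 1)))) (by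
      rw [norm_smul_sphere y (by linarith)]
      have : (1 / 2 : ℝ) ^ (n ^ 2) ≤ (1 / 2) ^ t :=
        pow_le_pow_of_le_one (by norm_num) (by norm_num) htn
      linarith)
    rw [norm_sub_rev] at h2
    have h3 := norm_sub_norm_le (poissonIntegral (gridPerturb φ n x c)
      ((1 - (1 / 2) ^ t : ℝ) • (y : EuclideanSpace ℝ (Fin (d + 1)))))
      (poissonIntegral μ ((1 - (1 / 2) ^ t : ℝ) • (y : EuclideanSpace ℝ (Fin (d + 1)))))
    have h4 : lowerConst d a / n ≤ lowerConst d a * 2 ^ (d * (t - n)) / n := by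
      have := lowerConst_pos (d := d) ha
      gcongr
      exact le_mul_of_one_le_right this.le (one_le_pow₀ one_le_two)
    linarith

/-- The Poisson integral is jointly continuous on the unit ball of measures and the open ball. -/
lemma continuous_poissonIntegral : Continuous
    fun p : unitBall d × Metric.ball (0 : EuclideanSpace ℝ (Fin (d + 1))) 1 =>
      poissonIntegral (p.1 : Measures d) (p.2 : EuclideanSpace ℝ (Fin (d + 1))) := by
  let κ : C(Metric.ball (0 : EuclideanSpace ℝ (Fin (d + 1))) 1, C(Sphere d, ℂ)) :=
    ContinuousMap.curry ⟨_, continuous_kernel_uncurried⟩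
  have hP : ∀ (μ : Measures d) (z : Metric.ball (0 : EuclideanSpace ℝ (Fin (d + 1))) 1),
      poissonIntegral μ z = pairing μ (κ z) := fun _ _ => rfl
  rw [continuous_iff_continuousAt]
  rintro ⟨μ₀, z₀⟩
  have h1 : Tendsto (fun p : unitBall d × Metric.ball (0 : EuclideanSpace ℝ (Fin (d + 1))) 1 =>
      ‖κ p.2 - κ z₀‖ + ‖pairing (p.1 : Measures d) (κ z₀) - pairing (μ₀ : Measures d) (κ z₀)‖)
      (𝓝 (μ₀, z₀)) (𝓝 0) := by
    have hc : Continuous fun p : unitBall d ×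
        Metric.ball (0 : EuclideanSpace ℝ (Fin (d + 1))) 1 => ‖κ p.2 - κ z₀‖ +
          ‖pairing (p.1 : Measures d) (κ z₀) - pairing (μ₀ : Measures d) (κ z₀)‖ := by
      have hp : Continuous fun μ : Measures d => pairing μ (κ z₀) := by
        have h0 : Continuous fun (μ : Measures d) (g : C(Sphere d, ℂ)) => pairing μ g :=
          continuous_induced_dom
        exact (continuous_apply (κ z₀)).comp h0
      have hp' : Continuous fun p : unitBall d ×
          Metric.ball (0 : EuclideanSpace ℝ (Fin (d + 1))) 1 =>
            pairing (p.1 : Measures d) (κ z₀) :=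
        hp.comp (continuous_subtype_val.comp continuous_fst)
      exact ((κ.continuous.comp continuous_snd).sub continuous_const).norm.add
        (hp'.sub continuous_const).norm
    have := hc.tendsto (μ₀, z₀)
    simpa using this
  rw [ContinuousAt, tendsto_iff_norm_sub_tendsto_zero]
  refine squeeze_zero (fun _ => norm_nonneg _) (fun p => ?_) h1
  have e : poissonIntegral (p.1 : Measures d) (p.2 : EuclideanSpace ℝ (Fin (d + 1))) -
      poissonIntegral (μ₀ : Measures d) (z₀ : EuclideanSpace ℝ (Fin (d + 1))) =
      pairing (p.1 : Measures d) (fun ξ => κ p.2 ξ - κ z₀ ξ) +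
        (pairing (p.1 : Measures d) (κ z₀) - pairing (μ₀ : Measures d) (κ z₀)) := by
    rw [pairing_sub p.1.2 (κ p.2).continuous (κ z₀).continuous]
    rw [hP p.1 p.2, hP μ₀ z₀]
    ring
  rw [e]
  refine (norm_add_le _ _).trans ?_
  gcongr
  refine norm_pairing_le p.1.2 (norm_nonneg _) fun ξ => ?_
  exact (κ p.2 - κ z₀).norm_coe_le_norm ξ

/-- Joint continuity and compactness of the closed ball of radius `r < 1` make the uniform estimate
stable under small perturbations of `μ`. -/
lemma isOpen_setOf_poissonIntegral_near {ν : Measures d} (hν : ν ∈ unitBall d) {r : ℝ}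
    (hr : r < 1) (ε : ℝ) :
    IsOpen {μ : unitBall d | ∀ z : EuclideanSpace ℝ (Fin (d + 1)), ‖z‖ ≤ r →
      ‖poissonIntegral (μ : Measures d) z - poissonIntegral ν z‖ < ε} := by
  let K : Set (Metric.ball (0 : EuclideanSpace ℝ (Fin (d + 1))) 1) :=
    {z | ‖(z : EuclideanSpace ℝ (Fin (d + 1)))‖ ≤ r}
  have hK : IsCompact K := by
    rw [Subtype.isCompact_iff]
    suffices himage : Subtype.val '' K =
        Metric.closedBall (0 : EuclideanSpace ℝ (Fin (d + 1))) r by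
      rw [himage]
      exact isCompact_closedBall _ _
    ext z
    simp only [K, Set.mem_image, Set.mem_ofPred_eq, Subtype.exists, Metric.mem_ball, dist_zero_right,
      exists_and_left, exists_prop, exists_eq_right_right, Metric.mem_closedBall]
    exact ⟨fun h => h.1, fun h => ⟨h, h.trans_lt hr⟩⟩
  have hcont : Continuous
      fun p : unitBall d × Metric.ball (0 : EuclideanSpace ℝ (Fin (d + 1))) 1 =>
        ‖poissonIntegral (p.1 : Measures d) (p.2 : EuclideanSpace ℝ (Fin (d + 1))) -
          poissonIntegral ν (p.2 : EuclideanSpace ℝ (Fin (d + 1)))‖ :=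
    (continuous_poissonIntegral.sub (continuous_poissonIntegral.comp
      (Continuous.prodMk (continuous_const (y := (⟨ν, hν⟩ : unitBall d))) continuous_snd))).norm
  rw [isOpen_iff_eventually]
  intro μ hμ
  have h := hK.eventually_forall_of_forall_eventually (x₀ := μ)
    (P := fun μ z => ‖poissonIntegral (μ : Measures d) (z : EuclideanSpace ℝ (Fin (d + 1))) -
          poissonIntegral ν (z : EuclideanSpace ℝ (Fin (d + 1)))‖ < ε)
    (fun z hz => (isOpen_lt hcont continuous_const).eventually_mem (hμ z hz))
  filter_upwards [h] with μ' hμ' z hz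
  exact hμ' ⟨z, by simpa using hz.trans_lt hr⟩ hz

lemma eventually_large (d m : ℕ) {a : ℝ} (ha : 0 ≤ a) : ∀ᶠ n : ℕ in atTop,
    (2 * n : ℝ) ^ (d + 1) * 2 * n * (1 / 2) ^ n ≤ lowerConst d a ∧ (m : ℝ) ≤ Real.log n := by
  have h1 : Tendsto (fun n : ℕ => (2 ^ (d + 2) : ℝ) * ((n : ℝ) ^ (d + 2) * (1 / 2) ^ n)) atTop
      (𝓝 ((2 ^ (d + 2) : ℝ) * 0)) :=
    (tendsto_pow_const_mul_const_pow_of_lt_one (d + 2) (by norm_num) (by norm_num)).const_mul _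
  rw [mul_zero] at h1
  filter_upwards [h1.eventually_le_const (lowerConst_pos (d := d) ha),
    (Real.tendsto_log_atTop.comp tendsto_natCast_atTop_atTop).eventually_ge_atTop (m : ℝ)]
    with n hn hm
  refine ⟨le_trans (le_of_eq ?_) hn, hm⟩
  ring

/-- A generic measure of the unit ball has large values at infinitely many levels. -/
theorem residual_frequently_hasLargeValues (φ : (Fin d → ℝ) → Sphere d) {a : ℝ} (ha : 0 ≤ a) :
    ∀ᶠ μ : unitBall d in residual (unitBall d),
      ∃ᶠ n in atTop, HasLargeValues φ a (μ : Measures d) n := by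
  simp_rw [frequently_atTop]
  rw [eventually_countable_forall]
  intro N
  let I := {p : ℕ × Σ m : ℕ, (Fin m → Sphere d) × (Fin m → ℂ) // N ≤ p.1 ∧ 1 ≤ p.1 ∧
    ∑ i, ‖p.2.2.2 i‖ ≤ 1 ∧
    (2 * p.1 : ℝ) ^ (d + 1) * 2 * p.1 * (1 / 2) ^ p.1 ≤ lowerConst d a ∧
    (p.2.1 : ℝ) ≤ Real.log p.1}
  let ν : I → Measures d := fun p => gridPerturb φ p.1.1 p.1.2.2.1 p.1.2.2.2
  have hν : ∀ p : I, ν p ∈ unitBall d := fun p =>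
    gridPerturb_mem_unitBall φ p.2.2.1 _ p.2.2.2.1
  let W : Set (unitBall d) := ⋃ p : I, {μ | ∀ z : EuclideanSpace ℝ (Fin (d + 1)),
    ‖z‖ ≤ 1 - (1 / 2) ^ (p.1.1 ^ 2) →
      ‖poissonIntegral (μ : Measures d) z - poissonIntegral (ν p) z‖ < lowerConst d a / p.1.1}
  have hWopen : IsOpen W := isOpen_iUnion fun p =>
    isOpen_setOf_poissonIntegral_near (hν p) (by
      have : (0 : ℝ) < (1 / 2) ^ (p.1.1 ^ 2) := by positivity
      linarith) _
  have hmem : ∀ p : I, (⟨ν p, hν p⟩ : unitBall d) ∈ W := fun p => by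
    refine Set.mem_iUnion.2 ⟨p, fun z _ => ?_⟩
    rw [sub_self, norm_zero]
    have : (0 : ℝ) < p.1.1 := by exact_mod_cast p.2.2.1
    exact div_pos (lowerConst_pos ha) this
  have hWdense : Dense W := by
    intro μ
    -- The error depends on `g` only through its norm and modulus of continuity, so one sequence of
    -- perturbed measures converges to `μ` against every continuous `g`; this gives weak-star
    -- density.
    have key : ∀ j : ℕ, ∃ p : I, ∀ (g : C(Sphere d, ℂ)) (η : ℝ), 0 ≤ η →
        (∀ u v, dist u v < 1 / ((j : ℝ) + 1) → ‖g u - g v‖ ≤ η) →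
        ‖pairing (ν p) g - pairing (μ : Measures d) g‖ ≤ 2 * ‖g‖ / ((j : ℝ) + 1) + η := by
      intro j
      obtain ⟨m, x, c, hc, happ⟩ := exists_discretization μ.2
        (show (0 : ℝ) < 1 / ((j : ℝ) + 1) by positivity)
      obtain ⟨n, ⟨hlarge, hm⟩, hn⟩ :=
        ((eventually_large d m ha).and (eventually_ge_atTop (max N (j + 1)))).exists
      have hnN : N ≤ n := (le_max_left _ _).trans hn
      have hnj : j + 1 ≤ n := (le_max_right _ _).trans hn
      refine ⟨⟨⟨n, m, x, c⟩, hnN, by omega, hc, hlarge, hm⟩, fun g η hη hosc => ?_⟩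
      have h1 := norm_pairing_gridPerturb_sub_le φ (show 1 ≤ n by omega) x hc g.continuous
        (norm_nonneg g) g.norm_coe_le_norm
      have h2 := happ g η g.continuous hη hosc
      have h3 : 2 * ‖g‖ / (n : ℝ) ≤ 2 * ‖g‖ / ((j : ℝ) + 1) := by
        gcongr
        exact_mod_cast hnj
      have h4 := norm_add_le (pairing (gridPerturb φ n x c) g - ∑ i, g (x i) * c i)
        (∑ i, g (x i) * c i - pairing (μ : Measures d) g)
      rw [sub_add_sub_cancel] at h4
      exact h4.trans (add_le_add (h1.trans h3) h2)
    choose p hp using key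
    refine mem_closure_of_tendsto (f := fun j => (⟨ν (p j), hν (p j)⟩ : unitBall d)) (b := atTop) ?_
      (Eventually.of_forall fun j => hmem (p j))
    rw [tendsto_subtype_rng, nhds_induced, tendsto_comap_iff, tendsto_pi_nhds]
    intro g
    rw [Metric.tendsto_atTop']
    intro ε hε
    obtain ⟨δ, hδ, hosc⟩ := Metric.uniformContinuous_iff.1
      (CompactSpace.uniformContinuous_of_continuous g.continuous) (ε / 2) (by linarith)
    have hlim : ∀ b : ℝ, Tendsto (fun j : ℕ => b / ((j : ℝ) + 1)) atTop (𝓝 0) := fun b =>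
      tendsto_const_nhds.div_atTop (tendsto_natCast_atTop_atTop.atTop_add tendsto_const_nhds)
    have hev := ((hlim 1).eventually_lt_const hδ).and
      ((hlim (2 * ‖g‖)).eventually_lt_const (show 0 < ε / 2 by linarith))
    obtain ⟨j₀, hj₀⟩ := eventually_atTop.1 hev
    refine ⟨j₀, fun j hj => ?_⟩
    obtain ⟨hj1, hj2⟩ := hj₀ j hj.le
    have := hp j g (ε / 2) (by linarith) fun u v huv => by
      rw [← dist_eq_norm]
      exact (hosc (huv.trans hj1)).le
    rw [dist_eq_norm]
    exact this.trans_lt (by linarith)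
  filter_upwards [residual_of_dense_open hWopen hWdense] with μ hμ
  obtain ⟨p, hpμ⟩ := Set.mem_iUnion.1 hμ
  exact ⟨p.1.1, p.2.1, hasLargeValues_of_near φ p.2.2.1 _ p.2.2.2.1 ha p.2.2.2.2.1 p.2.2.2.2.2 hpμ⟩

/-! ### Lower bound: dimension of the level sets -/

lemma le_growthExponent {μ : Measures d} {y : Sphere d} {β : ℝ}
    (h : ∀ β' : ℝ, β' < β → ∃ᶠ t : ℕ in atTop, (2 : ℝ) ^ (β' * t) ≤
      ‖poissonIntegral μ ((1 - (1 / 2) ^ t : ℝ) • (y : EuclideanSpace ℝ (Fin (d + 1))))‖) :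
    (β : EReal) ≤ growthExponent μ y := by
  by_contra! hlt
  obtain ⟨β', h1, h2⟩ := EReal.lt_iff_exists_real_btwn.1 hlt
  refine (not_le.2 h1) (le_limsup_of_frequently_le ?_)
  have htend : Tendsto (fun t : ℕ => (1 - (1 / 2) ^ t : ℝ)) atTop (𝓝[<] 1) := by
    refine tendsto_nhdsWithin_iff.2 ⟨?_, Eventually.of_forall fun t => ?_⟩
    · have : Tendsto (fun t : ℕ => (1 - (1 / 2) ^ t : ℝ)) atTop (𝓝 (1 - 0)) :=
        tendsto_const_nhds.sub (tendsto_pow_atTop_nhds_zero_of_lt_one (by norm_num) (by norm_num))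
      rwa [sub_zero] at this
    · simp
  refine htend.frequently (((h β' (EReal.coe_lt_coe_iff.1 h2)).and_eventually
    (eventually_ge_atTop 1)).mono ?_)
  rintro t ⟨ht, ht1⟩
  have htpos : (0 : ℝ) < t := by exact_mod_cast ht1
  have hl2 : 0 < Real.log 2 := Real.log_pos one_lt_two
  have e1 : -Real.log (1 - (1 - (1 / 2) ^ t)) = t * Real.log 2 := by
    rw [sub_sub_cancel, Real.log_pow, one_div, Real.log_inv]; ring
  have e2 : (β' : EReal) = ((β' * t * Real.log 2 : ℝ) : EReal) / ((t * Real.log 2 : ℝ) : EReal) := by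
    rw [← EReal.coe_div, mul_assoc, mul_div_cancel_right₀ _ (by positivity)]
  rw [e1, e2]
  refine EReal.div_le_div_right_of_nonneg (by exact_mod_cast (by positivity)) ?_
  have hb : ENNReal.ofReal ((2 : ℝ) ^ (β' * t)) ≤ ‖poissonIntegral μ
      ((1 - (1 / 2) ^ t : ℝ) • (y : EuclideanSpace ℝ (Fin (d + 1))))‖ₑ := by
    rw [← ofReal_norm]
    exact ENNReal.ofReal_le_ofReal ht
  refine le_trans (le_of_eq ?_) (ENNReal.log_le_log hb)
  rw [ENNReal.log_ofReal_of_pos (by positivity), Real.log_rpow two_pos]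

/-- With `n ≈ N` and `t ≈ α N`, the exponent `D (t - n) - β' t` is about `κ N` with `κ = (D - β') α
- D > 0`. Half of this gain absorbs `D √N`, the other half `c` and the division by `n`. -/
lemma eventually_rpow_le {D β' α c : ℝ} (hD : 0 ≤ D) (hα : 1 ≤ α) (hβ' : β' ≤ D)
    (hκ : D < (D - β') * α) (hc : 0 < c) :
    ∀ᶠ N : ℕ in atTop, ∀ n t : ℕ, 0 < n → (n : ℝ) ≤ N + √N → α * (N + 1) - 1 ≤ t →
      (2 : ℝ) ^ (β' * t) ≤ c * 2 ^ (D * (t - n)) / n := by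
  set κ := (D - β') * α - D with hκdef
  have hκ0 : 0 < κ := by linarith
  set r : ℝ := 2 ^ (-(κ / 2)) with hr
  have hr0 : 0 < r := by positivity
  have hr1 : r < 1 := Real.rpow_lt_one_of_one_lt_of_neg one_lt_two (by linarith)
  have hev1 := (tendsto_self_mul_const_pow_of_lt_one hr0.le hr1).eventually_le_const
    (show 0 < c / 2 by linarith)
  have hev2 := (Real.tendsto_sqrt_atTop.comp tendsto_natCast_atTop_atTop).eventually_ge_atTop
    (max 1 (2 * D / κ))
  filter_upwards [hev1, hev2] with N h1 h2 n t hn hnN ht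
  have hs1 : 1 ≤ √(N : ℝ) := (le_max_left _ _).trans h2
  have hs2 : 2 * D / κ ≤ √(N : ℝ) := (le_max_right _ _).trans h2
  have hsq : √(N : ℝ) * √(N : ℝ) = N := Real.mul_self_sqrt (Nat.cast_nonneg N)
  have hn0 : (0 : ℝ) < n := by exact_mod_cast hn
  have h3 : D * √(N : ℝ) ≤ κ / 2 * N := by
    rw [div_le_iff₀ hκ0] at hs2
    nlinarith [Real.sqrt_nonneg (N : ℝ)]
  have h4 : β' * t + κ / 2 * N ≤ D * (t - n) := by
    have a1 : (D - β') * (α * (N + 1) - 1) ≤ (D - β') * t :=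
      mul_le_mul_of_nonneg_left ht (by linarith)
    have a2 : D * n ≤ D * (N + √(N : ℝ)) := mul_le_mul_of_nonneg_left hnN hD
    have a3 : 0 ≤ (D - β') * (α - 1) := mul_nonneg (by linarith) (by linarith)
    have a4 : κ * N = (D - β') * α * N - D * N := by rw [hκdef]; ring
    nlinarith
  have h5 : (n : ℝ) ≤ 2 * N := by nlinarith
  have h6 : r ^ N * 2 ^ (κ / 2 * N) = 1 := by
    rw [hr, ← Real.rpow_natCast, ← Real.rpow_mul two_pos.le, ← Real.rpow_add two_pos]
    simp
  rw [le_div_iff₀ hn0]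
  have hA : (0 : ℝ) < 2 ^ (κ / 2 * N) := by positivity
  have h7 : (n : ℝ) ≤ c * 2 ^ (κ / 2 * N) := by
    calc (n : ℝ) ≤ 2 * (N * (r ^ N * 2 ^ (κ / 2 * N))) := by rw [h6]; linarith
      _ = 2 * (N * r ^ N) * 2 ^ (κ / 2 * N) := by ring
      _ ≤ 2 * (c / 2) * 2 ^ (κ / 2 * N) := by gcongr
      _ = _ := by ring
  calc (2 : ℝ) ^ (β' * t) * n ≤ 2 ^ (β' * t) * (c * 2 ^ (κ / 2 * N)) := by gcongr
    _ = c * 2 ^ (β' * t + κ / 2 * N) := by rw [Real.rpow_add two_pos]; ring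
    _ ≤ _ := by gcongr; norm_num

/-- A map of a set of positive volume whose inverse is Hölder has image of positive Hausdorff
measure. -/
lemma hausdorffMeasure_image_ne_zero {Y : Type*} [MetricSpace Y] [MeasurableSpace Y] [BorelSpace Y]
    {Ψ : (Fin d → ℝ) → Y} {X : Set (Fin d → ℝ)} (hX : volume X ≠ 0) {C r : ℝ} (hC : 0 ≤ C)
    (hr : 0 < r) (h : ∀ x ∈ X, ∀ x' ∈ X, dist x x' ≤ C * dist (Ψ x) (Ψ x') ^ r) :
    μH[r * d] (Ψ '' X) ≠ 0 := by
  have hinj : Set.InjOn Ψ X := fun x hx x' hx' hxx' => by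
    have := h x hx x' hx'
    rw [hxx', dist_self, Real.zero_rpow hr.ne', mul_zero] at this
    exact dist_le_zero.1 this
  have hinv := hinj.leftInvOn_invFunOn
  set f := Function.invFunOn Ψ X
  have hf : HolderOnWith C.toNNReal r.toNNReal f (Ψ '' X) := by
    rintro _ ⟨x, hx, rfl⟩ _ ⟨x', hx', rfl⟩
    rw [hinv hx, hinv hx', edist_dist, edist_dist, Real.coe_toNNReal _ hr.le,
      ENNReal.ofReal_rpow_of_nonneg dist_nonneg hr.le, ← ENNReal.ofReal.eq_1 C,
      ← ENNReal.ofReal_mul hC]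
    exact ENNReal.ofReal_le_ofReal (h x hx x' hx')
  have himage : f '' (Ψ '' X) = X := hinv.image_image
  have hle := hf.hausdorffMeasure_image_le (Real.toNNReal_pos.2 hr) (Nat.cast_nonneg d)
  rw [himage, Real.coe_toNNReal _ hr.le] at hle
  have hvol : (μH[(d : ℝ)] : Measure (Fin d → ℝ)) = volume := by
    have := hausdorffMeasure_pi_real (ι := Fin d)
    rwa [Fintype.card_fin] at this
  rw [hvol] at hle
  intro h0
  rw [h0, mul_zero] at hle
  exact hX (le_antisymm hle zero_le)

/-- Volume bound for the excluded points: at most `log n` sets, each of diameter at most `4 (A /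
n)^ρ`. The logarithmic bound on their number is beaten by every power, hence works for every `β`. -/
lemma tendsto_log_mul_rpow (hd : 1 ≤ d) {ρ A : ℝ} (hρ : 0 < ρ) (hA : 0 ≤ A) :
    Tendsto (fun n : ℕ => Real.log n * (4 * (A / n) ^ ρ) ^ d) atTop (𝓝 0) := by
  have hρd : 0 < ρ * d := by
    have : (0 : ℝ) < d := by exact_mod_cast hd
    positivity
  have h1 := (isLittleO_log_rpow_atTop hρd).tendsto_div_nhds_zero.comp tendsto_natCast_atTop_atTop
  have h2 := h1.const_mul ((4 * A ^ ρ) ^ d)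
  rw [mul_zero] at h2
  refine h2.congr fun n => ?_
  simp only [Function.comp_apply]
  rw [Real.div_rpow hA (Nat.cast_nonneg n), Real.rpow_mul (Nat.cast_nonneg n), Real.rpow_natCast,
    ← mul_div_assoc 4, div_pow]
  ring

theorem hausdorffMeasure_le_growthExponent_ne_zero (hd : 1 ≤ d) {φ : (Fin d → ℝ) → Sphere d}
    {K : ℝ} (hK : 1 ≤ K) (hφ : ∀ u v, dist (φ u) (φ v) ≤ K * dist u v)
    (hφ' : ∀ u ∈ Set.Icc (0 : Fin d → ℝ) 1, ∀ v ∈ Set.Icc (0 : Fin d → ℝ) 1,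
      dist u v ≤ K * dist (φ u) (φ v))
    {μ : Measures d} (hμ : ∃ᶠ n in atTop, HasLargeValues φ (2 * K) μ n)
    {β : ℝ} (hβ : 0 ≤ β) (hβd : β < d) :
    μH[d - β] {y : Sphere d | (β : EReal) ≤ growthExponent μ y} ≠ 0 := by
  have hdpos : (0 : ℝ) < d := by exact_mod_cast hd
  -- This makes `d / α = d - β` the dimension and `d (1 - 1 / α) = β` the growth exponent.
  set α : ℝ := d / (d - β) with hαdef
  have hα : 1 ≤ α := by
    rw [hαdef, one_le_div (by linarith)]; linarith
  have hα0 : 0 < α := by linarith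
  set J : Set ℕ := {n | HasLargeValues φ (2 * K) μ n}
  have hq := jumpSeq_strictMono J hα
  have hqα := jumpSeq_le J hα
  have hjump := frequently_jump J hα hμ
  set q := jumpSeq J α with hqdef
  have hq0 : q 0 = 0 := rfl
  let S : (Fin d → ℝ) → (Fin d → ℝ) := fun x i => spread q (x i)
  let Q : Set (Fin d → ℝ) := Set.univ.pi fun _ => Set.Ico 0 1
  have hSQ : ∀ x ∈ Q, S x ∈ Set.Icc (0 : Fin d → ℝ) 1 := fun x hx =>
    ⟨fun i => (spread_mem_unit hq hq0 (hx i (Set.mem_univ i))).1,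
      fun i => (spread_mem_unit hq hq0 (hx i (Set.mem_univ i))).2⟩
  let Ψ : (Fin d → ℝ) → Sphere d := fun x => φ (S x)
  have hholder : ∀ x ∈ Q, ∀ x' ∈ Q, dist x x' ≤ 4 * (K * dist (Ψ x) (Ψ x')) ^ (1 / α) := by
    intro x hx x' hx'
    refine (dist_pi_le_iff (by positivity)).2 fun i => ?_
    refine (abs_sub_le_spread hq hα hqα (hx i (Set.mem_univ i)) (hx' i (Set.mem_univ i))).trans ?_
    gcongr
    exact (dist_le_pi_dist (S x) (S x') i).trans (hφ' _ (hSQ x hx) _ (hSQ x' hx'))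
  have hchoose : ∀ n, ∃ F : Finset (Sphere d), n ∈ J → ((F.card : ℝ) ≤ Real.log n ∧
      ∀ y : Sphere d, (∀ ξ ∈ F, 1 / (n : ℝ) ≤ dist y ξ) → ∀ t : ℕ, n ≤ t → t ≤ n ^ 2 →
        ∀ k : Fin d → ℕ, (∀ i, k i < 2 ^ n) → dist y (φ (dyadicPoint n k)) ≤ 2 * K * (1 / 2) ^ t →
        lowerConst d (2 * K) * 2 ^ (d * (t - n)) / n ≤ ‖poissonIntegral μ
          ((1 - (1 / 2) ^ t : ℝ) • (y : EuclideanSpace ℝ (Fin (d + 1))))‖) := by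
    intro n
    by_cases hn : n ∈ J
    · obtain ⟨F, hF⟩ := hn
      exact ⟨F, fun _ => hF⟩
    · exact ⟨∅, fun h => absurd h hn⟩
  choose F hF using hchoose
  let bad : ℕ → Set (Fin d → ℝ) := fun n => ⋃ ξ ∈ F n, {x ∈ Q | dist (Ψ x) ξ < 1 / (n : ℝ)}
  have hbad : ∀ n ∈ J, volume (bad n) ≤
      ENNReal.ofReal (Real.log n * (4 * (K * 2 / n) ^ (1 / α)) ^ d) := by
    intro n hn
    have h1 : ∀ ξ, volume {x ∈ Q | dist (Ψ x) ξ < 1 / (n : ℝ)} ≤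
        ENNReal.ofReal ((4 * (K * 2 / n) ^ (1 / α)) ^ d) := by
      intro ξ
      refine (Real.volume_pi_le_diam_pow _).trans ?_
      rw [Fintype.card_fin, ENNReal.ofReal_pow (by positivity)]
      gcongr
      refine Metric.ediam_le_of_forall_dist_le fun x hx x' hx' => ?_
      refine (hholder x hx.1 x' hx'.1).trans ?_
      gcongr
      have := dist_triangle_right (Ψ x) (Ψ x') ξ
      rw [mul_div_assoc]
      gcongr
      have e : (2 : ℝ) / n = 1 / n + 1 / n := by ring
      rw [e]
      exact this.trans (add_le_add hx.2.le hx'.2.le)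
    calc volume (bad n) ≤ ∑ ξ ∈ F n, volume {x ∈ Q | dist (Ψ x) ξ < 1 / (n : ℝ)} :=
          measure_biUnion_finset_le _ _
      _ ≤ ∑ _ξ ∈ F n, ENNReal.ofReal ((4 * (K * 2 / n) ^ (1 / α)) ^ d) :=
          Finset.sum_le_sum fun ξ _ => h1 ξ
      _ = ENNReal.ofReal ((F n).card) * ENNReal.ofReal ((4 * (K * 2 / n) ^ (1 / α)) ^ d) := by
          rw [Finset.sum_const, nsmul_eq_mul, ENNReal.ofReal_natCast]
      _ ≤ _ := by
          rw [ENNReal.ofReal_mul' (by positivity)]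
          gcongr
          exact (hF n hn).1
  let P : ℕ → Prop := fun N => q N ∈ J ∧ (q N - N) ^ 2 ≤ N
  -- Parameters avoiding the bad balls at infinitely many jumps. A point of `Q` outside `X` is bad
  -- at all late jumps, which has probability zero because the bad volumes tend to `0`.
  let X : Set (Fin d → ℝ) := {x ∈ Q | ∃ᶠ N in atTop, P N ∧ x ∉ bad (q N)}
  have hbadlim : Tendsto (fun N => ENNReal.ofReal
      (Real.log (q N) * (4 * (K * 2 / q N) ^ (1 / α)) ^ d)) atTop (𝓝 0) := by
    have h1 := (tendsto_log_mul_rpow hd (ρ := 1 / α) (A := K * 2) (by positivity)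
      (by positivity)).comp hq.tendsto_atTop
    have h2 := ENNReal.tendsto_ofReal h1
    rwa [ENNReal.ofReal_zero] at h2
  have hX : volume X ≠ 0 := by
    have hnull : ∀ M : ℕ, volume (⋂ N ∈ {N | M ≤ N ∧ P N}, bad (q N)) = 0 := by
      intro M
      by_contra hne
      have hev := hbadlim.eventually_lt_const (pos_iff_ne_zero.2 hne)
      obtain ⟨N, hN, hN1, hN2⟩ := ((hjump.and_eventually
        ((eventually_ge_atTop M).and hev))).exists
      have hsub : (⋂ N ∈ {N | M ≤ N ∧ P N}, bad (q N)) ⊆ bad (q N) :=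
        Set.biInter_subset_of_mem ⟨hN1, hN⟩
      exact absurd ((measure_mono hsub).trans (hbad _ hN.1)) (not_le.2 hN2)
    have hsub : Q ⊆ X ∪ ⋃ M : ℕ, ⋂ N ∈ {N | M ≤ N ∧ P N}, bad (q N) := by
      intro x hx
      by_cases hfr : ∃ᶠ N in atTop, P N ∧ x ∉ bad (q N)
      · exact Or.inl ⟨hx, hfr⟩
      · rw [not_frequently, eventually_atTop] at hfr
        obtain ⟨M, hM⟩ := hfr
        refine Or.inr (Set.mem_iUnion.2 ⟨M, Set.mem_iInter₂.2 fun N hN => ?_⟩)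
        by_contra hx'
        exact hM N hN.1 ⟨hN.2, hx'⟩
    intro h0
    have hQ0 : volume Q = 0 :=
      measure_mono_null hsub (measure_union_null h0 (measure_iUnion_null hnull))
    have hQ1 : volume Q = 1 := by
      simp only [Q]
      rw [volume_pi_pi]
      simp
    exact zero_ne_one (hQ0.symm.trans hQ1)
  have hgrow : Ψ '' X ⊆ {y : Sphere d | (β : EReal) ≤ growthExponent μ y} := by
    rintro _ ⟨x, ⟨hxQ, hfr⟩, rfl⟩
    refine le_growthExponent fun β' hβ' => ?_
    have hκ : (d : ℝ) < (d - β') * α := by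
      rw [hαdef, mul_div_assoc', lt_div_iff₀ (by linarith)]
      nlinarith
    have hev := eventually_rpow_le (Nat.cast_nonneg d) hα (by linarith : β' ≤ d) hκ
      (lowerConst_pos (d := d) (a := 2 * K) (by linarith))
    have hbig := tendsto_natCast_atTop_atTop.eventually_ge_atTop (max 1 (2 * α))
    have htend : Tendsto (fun N => q (N + 1)) atTop atTop :=
      hq.tendsto_atTop.comp (tendsto_add_atTop_nat 1)
    -- At a jump the relevant scales are `n = q N` for the grid and `t = q (N + 1)` for the radius:
    -- all digits in between vanish.
    refine htend.frequently ((hfr.and_eventually (hev.and hbig)).mono ?_)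
    rintro N ⟨⟨⟨hNJ, hNsq⟩, hNbad⟩, hNev, hNbig⟩
    have hN1 : (1 : ℝ) ≤ N := (le_max_left _ _).trans hNbig
    have hN2 : 2 * α ≤ N := (le_max_right _ _).trans hNbig
    have hNq : N ≤ q N := hq.id_le N
    have hNq' : (N : ℝ) ≤ q N := by exact_mod_cast hNq
    have hqlt : q N < q (N + 1) := hq (Nat.lt_succ_self N)
    have hq1 : q (N + 1) = ⌊α * (N + 1)⌋₊ := by
      rw [hqdef, jumpSeq, if_pos ⟨hNJ, hNsq⟩]
    have hdist : ∀ ξ ∈ F (q N), 1 / (q N : ℝ) ≤ dist (Ψ x) ξ := by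
      intro ξ hξ
      by_contra! hlt
      exact hNbad (Set.mem_biUnion hξ ⟨hxQ, hlt⟩)
    choose k hk hkd using fun i => exists_spread_near_dyadic hq hq0 (hxQ i (Set.mem_univ i)) N
    have hnear : dist (Ψ x) (φ (dyadicPoint (q N) k)) ≤ 2 * K * (1 / 2) ^ q (N + 1) := by
      have h1 : dist (S x) (dyadicPoint (q N) k) ≤ 2 * (1 / 2) ^ q (N + 1) :=
        (dist_pi_le_iff (by positivity)).2 fun i => by
          rw [Real.dist_eq]; exact hkd i
      refine (hφ _ _).trans ?_
      have := mul_le_mul_of_nonneg_left h1 (show 0 ≤ K by linarith)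
      linarith
    -- Here `α (N + 1) ≤ 2 α N ≤ N ^ 2`, so the scale stays in the window where `μ` imitates the
    -- grid measure.
    have htsq : q (N + 1) ≤ q N ^ 2 := by
      have h1 := hqα (N + 1)
      push_cast at h1
      have h2 : (q (N + 1) : ℝ) ≤ (q N : ℝ) ^ 2 := by nlinarith
      exact_mod_cast h2
    have hlower := (hF (q N) hNJ).2 (Ψ x) hdist (q (N + 1)) hqlt.le htsq k hk hnear
    refine le_trans ?_ hlower
    have hsqrt : (q N : ℝ) ≤ N + √N := by
      have h1 : ((q N : ℝ) - N) ^ 2 ≤ N := by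
        rw [← Nat.cast_sub hNq]
        exact_mod_cast hNsq
      have := Real.le_sqrt_of_sq_le h1
      linarith
    have hfloor : α * (N + 1) - 1 ≤ (q (N + 1) : ℕ) := by
      rw [hq1]
      exact (Nat.sub_one_lt_floor _).le
    have hpos : 0 < q N := by
      have : (0 : ℝ) < q N := by linarith
      exact_mod_cast this
    refine (hNev (q N) (q (N + 1)) hpos hsqrt hfloor).trans (le_of_eq ?_)
    congr 2
    rw [← Nat.cast_sub hqlt.le, ← Nat.cast_mul, Real.rpow_natCast]
  have hH : μH[1 / α * d] (Ψ '' X) ≠ 0 := by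
    refine hausdorffMeasure_image_ne_zero hX (C := 4 * K ^ (1 / α)) (by positivity) (by positivity)
      fun x hx x' hx' => ?_
    refine (hholder x hx.1 x' hx'.1).trans (le_of_eq ?_)
    rw [Real.mul_rpow (by linarith) dist_nonneg, mul_assoc]
  have hexp : 1 / α * d = d - β := by
    rw [hαdef, one_div_div, div_mul_cancel₀ _ hdpos.ne']
  rw [hexp] at hH
  exact fun h0 => hH (measure_mono_null hgrow h0)

/-- The set where the exponent is at least `β` has positive `H^(d-β)`-measure, while its part with
exponent above `β` is null by the upper bound at `t = d - β`, which is positive as `β < d`. -/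
theorem le_dimH_levelSet (hd : 1 ≤ d) {φ : (Fin d → ℝ) → Sphere d}
    {K : ℝ} (hK : 1 ≤ K) (hφ : ∀ u v, dist (φ u) (φ v) ≤ K * dist u v)
    (hφ' : ∀ u ∈ Set.Icc (0 : Fin d → ℝ) 1, ∀ v ∈ Set.Icc (0 : Fin d → ℝ) 1,
      dist u v ≤ K * dist (φ u) (φ v))
    {μ : Measures d} (hμ : μ ∈ unitBall d) (hlarge : ∃ᶠ n in atTop, HasLargeValues φ (2 * K) μ n)
    {β : ℝ} (hβ : 0 ≤ β) (hβd : β < d) : ENNReal.ofReal (d - β) ≤ dimH (levelSet β μ) := by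
  have h1 := hausdorffMeasure_le_growthExponent_ne_zero hd hK hφ hφ' hlarge hβ hβd
  have h2 := hausdorffMeasure_growthExponent_gt hμ (t := d - β) (by linarith) (by linarith)
  rw [sub_sub_cancel] at h2
  refine le_dimH_of_hausdorffMeasure_ne_zero (d := (d - β).toNNReal) ?_
  rw [Real.coe_toNNReal _ (by linarith)]
  intro h0
  refine h1 (measure_mono_null (fun y hy => ?_) (measure_union_null h0 h2))
  rcases (show (β : EReal) ≤ growthExponent μ y from hy).eq_or_lt with h | h
  · exact Or.inl h.symm
  · exact Or.inr h

end PoissonSphere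

theorem mainTheorem5 (d : ℕ) (hd : 1 ≤ d) :
    ∀ᶠ μ : PoissonSphere.unitBall d in residual (PoissonSphere.unitBall d),
      ∀ β : ℝ, β ∈ Set.Icc (0 : ℝ) (d : ℝ) →
        dimH (PoissonSphere.levelSet β (μ : PoissonSphere.Measures d)) =
          ENNReal.ofReal ((d : ℝ) - β) := by
  obtain ⟨φ, K, hK, hφ, hφ'⟩ := PoissonSphere.exists_bilipschitz_chart d
  filter_upwards [PoissonSphere.residual_frequently_hasLargeValues φ
    (show 0 ≤ 2 * K by linarith)] with μ hμ β hβ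
  refine le_antisymm (PoissonSphere.dimH_levelSet_le μ.2 hβ.1 hβ.2) ?_
  -- At `β = d` the lower bound is `0`, so nonemptiness of the level set is not needed.
  rcases hβ.2.lt_or_eq with h | h
  · exact PoissonSphere.le_dimH_levelSet hd hK hφ hφ' μ.2 hμ hβ.1 h
  · rw [h, sub_self, ENNReal.ofReal_zero]
    exact zero_le
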